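/- Let $n\ge 2$ and let $\theta=(\theta_1,\dots,\theta_n)\in\mathbb R^n$ be such that $1,\theta_1,\dots,\theta_n$ are linearly independent over $\mathbb Q$. Let $\lambda$ (respectively $\hat\lambda$) be the supremum of the real numbers $\gamma$ such that the system $\max_{1\le i\le n}|x_0\theta_i-x_i|\le t^{-\gamma}$, $0<|x_0|\le t$ has a solution $(x_0,\dots,x_n)\in\mathbb Z^{n+1}$ for some arbitrarily large real $t$ (respectively for every sufficiently large real $t$). Let $\omega$ (respectively $\hat\omega$) be the supremum of the real numbers $\gamma$ such that the system $|x_0+\theta_1x_1+\dots+\theta_nx_n|\le t^{-\gamma}$, $0<\max_{1\le i\le n}|x_i|\le t$ has a solution $(x_0,\dots,x_n)\in\mathbb Z^{n+1}$ for some arbitrarily large real $t$ (respectively for every sufficiently large real $t$). These exponents are elements of $[0,\infty]$, and we put $\infty^{-1}=0$. Let $G_{\mathrm{lin}}(\hat\omega)$ and $G_{\mathrm{sim}}(\hat\lambda)$ be the largest real roots of the polynomials $$f(x)=\hat\omega^{-1}x^n-x+(1-\hat\omega^{-1}),\qquad g(x)=(1-\hat\lambda)x^n-x^{n-1}+\hat\lambda$$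 respectively, with the conventions $G_{\mathrm{lin}}(\infty)=\infty$ and $G_{\mathrm{sim}}(1)=\infty$ (the cases in which the leading coefficient vanishes). Put $$B(\omega,\lambda)=\frac{1+\lambda}{1+\omega^{-1}},\qquad A(\hat\omega,\hat\lambda)=\frac{1-\hat\omega^{-1}}{1-\hat\lambda},$$ where $A=\infty$ if $\hat\lambda=1$. Then $$\frac{\omega}{\hat\omega}\ge\max\bigl(B(\omega,\lambda),G_{\mathrm{lin}}(\hat\omega)\bigr),\qquad \frac{\lambda}{\hat\lambda}\ge\max\bigl(B(\omega,\lambda),G_{\mathrm{sim}}(\hat\lambda)\bigr),$$ where, if $\hat\omega=\infty$, the first inequality is to be read as $\omega=\infty$. Moreover, $$B(\omega,\lambda)\ge A(\hat\omega,\hat\lambda)\ge\min\bigl(G_{\mathrm{lin}}(\hat\omega),G_{\mathrm{sim}}(\hat\lambda)\bigr).$$ -/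

import Mathlib

open scoped ENNReal

/-- The system `max_{1 ≤ i ≤ n} |x₀ θ_i - x_i| ≤ t ^ (-γ)`, `0 < |x₀| ≤ t` has a solution
`x = (x₀, ..., x_n) ∈ ℤ ^ (n + 1)`. -/
def SimSolvable {n : ℕ} (θ : Fin n → ℝ) (γ t : ℝ) : Prop :=
  ∃ x : Fin (n + 1) → ℤ,
    (∀ i : Fin n, |(x 0 : ℝ) * θ i - (x i.succ : ℝ)| ≤ t ^ (-γ)) ∧
    0 < |(x 0 : ℝ)| ∧ |(x 0 : ℝ)| ≤ t

/-- The system `|x₀ + θ_1 x_1 + ... + θ_n x_n| ≤ t ^ (-γ)`, `0 < max_{1 ≤ i ≤ n} |x_i| ≤ t` has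
a solution `x = (x₀, ..., x_n) ∈ ℤ ^ (n + 1)`. -/
def LinSolvable {n : ℕ} (θ : Fin n → ℝ) (γ t : ℝ) : Prop :=
  ∃ x : Fin (n + 1) → ℤ,
    |(x 0 : ℝ) + ∑ i : Fin n, θ i * (x i.succ : ℝ)| ≤ t ^ (-γ) ∧
    (∃ i : Fin n, 0 < |(x i.succ : ℝ)|) ∧ ∀ i : Fin n, |(x i.succ : ℝ)| ≤ t

/-! The four exponents are suprema of sets of real numbers `γ`, taken in `[0, ∞]`. The number
`γ = 0` always belongs to these sets, for `n ≥ 1`, so that the negative `γ` (which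
`ENNReal.ofReal` sends to `0`) do not matter. -/

/-- The regular exponent `λ(θ)` of simultaneous approximation. -/
noncomputable def lamReg {n : ℕ} (θ : Fin n → ℝ) : ℝ≥0∞ :=
  sSup (ENNReal.ofReal '' {γ : ℝ | ∃ᶠ t in Filter.atTop, SimSolvable θ γ t})

/-- The uniform exponent of simultaneous approximation. -/
noncomputable def lamUnif {n : ℕ} (θ : Fin n → ℝ) : ℝ≥0∞ :=
  sSup (ENNReal.ofReal '' {γ : ℝ | ∀ᶠ t in Filter.atTop, SimSolvable θ γ t})

/-- The regular exponent `ω(θ)` of the linear form. -/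
noncomputable def omegaReg {n : ℕ} (θ : Fin n → ℝ) : ℝ≥0∞ :=
  sSup (ENNReal.ofReal '' {γ : ℝ | ∃ᶠ t in Filter.atTop, LinSolvable θ γ t})

/-- The uniform exponent of the linear form. -/
noncomputable def omegaUnif {n : ℕ} (θ : Fin n → ℝ) : ℝ≥0∞ :=
  sSup (ENNReal.ofReal '' {γ : ℝ | ∀ᶠ t in Filter.atTop, LinSolvable θ γ t})

/-- The polynomial `f(x) = w⁻¹ x ^ n - x + (1 - w⁻¹)`. -/
noncomputable def polyLin (n : ℕ) (w : ℝ) : Polynomial ℝ :=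
  Polynomial.C w⁻¹ * Polynomial.X ^ n - Polynomial.X + Polynomial.C (1 - w⁻¹)

/-- The polynomial `g(x) = (1 - l) x ^ n - x ^ (n - 1) + l`. -/
noncomputable def polySim (n : ℕ) (l : ℝ) : Polynomial ℝ :=
  Polynomial.C (1 - l) * Polynomial.X ^ n - Polynomial.X ^ (n - 1) + Polynomial.C l

/-- The largest real root of a nonzero polynomial that has a real root. -/
noncomputable def largestRoot (p : Polynomial ℝ) : ℝ := sSup {x : ℝ | p.IsRoot x}

theorem isGreatest_largestRoot {p : Polynomial ℝ} (hp : p ≠ 0) {x : ℝ} (hx : p.IsRoot x) :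
    IsGreatest {x : ℝ | p.IsRoot x} (largestRoot p) := by
  have hfin : {x : ℝ | p.IsRoot x}.Finite := Polynomial.finite_setOfPred_isRoot hp
  exact ⟨Set.Nonempty.csSup_mem ⟨x, hx⟩ hfin, fun y hy => le_csSup hfin.bddAbove hy⟩

/-- `G_lin(w)`, the largest root of `f`; at `w = ∞`, where the leading coefficient of `f` vanishes,
it is `∞`, which is also the limit as `w → ∞`. -/
noncomputable def Glin (n : ℕ) (w : ℝ≥0∞) : ℝ≥0∞ :=
  if w = ⊤ then ⊤ else ENNReal.ofReal (largestRoot (polyLin n w.toReal))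

/-- `G_sim(l)`, the largest root of `g`; at `l = 1`, where the leading coefficient of `g` vanishes,
it is `∞`, which is also the limit as `l → 1` from below. -/
noncomputable def Gsim (n : ℕ) (l : ℝ≥0∞) : ℝ≥0∞ :=
  if l = 1 then ⊤ else ENNReal.ofReal (largestRoot (polySim n l.toReal))

/-- `B(w, l) = (1 + l) / (1 + w⁻¹)`, with `∞⁻¹ = 0`. -/
noncomputable def Bquot (w l : ℝ≥0∞) : ℝ≥0∞ := (1 + l) / (1 + w⁻¹)

/-- `A(w, l) = (1 - w⁻¹) / (1 - l)`, for `w > 1` and `l ≤ 1`, with `∞⁻¹ = 0` and value `∞`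
at `l = 1`. -/
noncomputable def Aquot (w l : ℝ≥0∞) : ℝ≥0∞ := (1 - w⁻¹) / (1 - l)

open Filter Topology

section Chain

variable {K V : Type*} [Field K] [AddCommGroup V] [Module K V]

/-- The subspaces obtained by greedily adding the first member of the sequence which is not in the
space spanned so far. -/
noncomputable def greedySpan (q : ℕ → V) : ℕ → Submodule K V
  | 0 => ⊥
  | k + 1 => greedySpan q k ⊔ Submodule.span K {q (sInf {j | q j ∉ greedySpan q k})}

variable (K) in
/-- The index of the `k`-th vector selected by the greedy algorithm. -/
noncomputable def greedyIndex (q : ℕ → V) (k : ℕ) : ℕ :=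
  sInf {j | q j ∉ greedySpan (K := K) q k}

theorem greedySpan_eq_span (q : ℕ → V) (k : ℕ) :
    greedySpan (K := K) q k =
      Submodule.span K (Set.range fun j : Fin k => q (greedyIndex K q j)) := by
  induction k with
  | zero => simp [greedySpan]
  | succ k ih =>
    have h : (Set.range fun j : Fin (k + 1) => q (greedyIndex K q j)) =
        (Set.range fun j : Fin k => q (greedyIndex K q j)) ∪ {q (greedyIndex K q k)} := by
      ext v
      simp [Fin.exists_fin_succ', eq_comm, or_comm]
    rw [h, Submodule.span_union, ← ih]
    rfl

theorem greedySpan_ne_top [FiniteDimensional K V] (q : ℕ → V) {k : ℕ}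
    (hk : k < Module.finrank K V) : greedySpan (K := K) q k ≠ ⊤ := by
  intro h
  have h1 : Module.finrank K (greedySpan (K := K) q k) ≤ k := by
    rw [greedySpan_eq_span]
    simpa [Set.finrank] using finrank_range_le_card (R := K) fun j : Fin k => q (greedyIndex K q j)
  rw [h, finrank_top] at h1
  omega

variable {q : ℕ → V}

theorem mem_greedySpan_of_lt {k i : ℕ} (h : i < greedyIndex K q k) :
    q i ∈ greedySpan (K := K) q k := by
  by_contra hi
  exact absurd (Nat.sInf_le (s := {j | q j ∉ greedySpan (K := K) q k}) hi) (not_le.2 h)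

theorem greedyIndex_notMem [FiniteDimensional K V]
    (hq : ∀ f : V →ₗ[K] K, (∀ i, f (q i) = 0) → f = 0) {k : ℕ} (hk : k < Module.finrank K V) :
    q (greedyIndex K q k) ∉ greedySpan (K := K) q k := by
  obtain ⟨f, hf, hle⟩ := Submodule.exists_le_ker_of_lt_top _
    (lt_top_iff_ne_top.2 (greedySpan_ne_top (K := K) q hk))
  have hne : {j | q j ∉ greedySpan (K := K) q k}.Nonempty := by
    by_contra hem
    rw [Set.not_nonempty_iff_eq_empty, Set.eq_empty_iff_forall_notMem] at hem
    refine hf (hq f fun i => ?_)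
    have := hem i
    simp only [Set.mem_ofPred_eq, not_not] at this
    exact hle this
  exact Nat.sInf_mem hne

theorem greedyIndex_mem_succ (k : ℕ) :
    q (greedyIndex K q k) ∈ greedySpan (K := K) q (k + 1) :=
  Submodule.mem_sup_right (Submodule.mem_span_singleton_self _)

theorem greedyIndex_lt_succ [FiniteDimensional K V]
    (hq : ∀ f : V →ₗ[K] K, (∀ i, f (q i) = 0) → f = 0) {k : ℕ}
    (hk : k + 1 < Module.finrank K V) : greedyIndex K q k < greedyIndex K q (k + 1) := by
  have h1 := greedyIndex_notMem hq hk
  by_contra! h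
  rcases h.lt_or_eq with h | h
  · exact h1 (Submodule.mem_sup_left (mem_greedySpan_of_lt h))
  · rw [h] at h1
    exact h1 (greedyIndex_mem_succ k)

theorem greedyIndex_zero (h0 : q 0 ≠ 0) : greedyIndex K q 0 = 0 := by
  refine Nat.sInf_eq_zero.2 (Or.inl ?_)
  simpa [greedySpan] using h0

theorem linearIndependent_greedy [FiniteDimensional K V]
    (hq : ∀ f : V →ₗ[K] K, (∀ i, f (q i) = 0) → f = 0) {k : ℕ} (hk : k ≤ Module.finrank K V) :
    LinearIndependent K fun j : Fin k => q (greedyIndex K q j) := by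
  induction k with
  | zero => exact linearIndependent_empty_type
  | succ k ih =>
    rw [linearIndependent_finSucc']
    refine ⟨ih (by omega), ?_⟩
    have := greedyIndex_notMem hq (k := k) (by omega)
    rw [greedySpan_eq_span] at this
    exact this

end Chain

theorem Matrix.abs_det_le_prod {d : ℕ} (M : Matrix (Fin d) (Fin d) ℝ) (c : Fin d → ℝ)
    (h : ∀ i j, |M i j| ≤ c i) : |M.det| ≤ d.factorial * ∏ i, c i := by
  rw [← Matrix.det_transpose, Matrix.det_apply]
  refine (Finset.abs_sum_le_sum_abs _ _).trans ?_
  have : ∀ σ ∈ (Finset.univ : Finset (Equiv.Perm (Fin d))),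
      |Equiv.Perm.sign σ • ∏ i, M.transpose (σ i) i| ≤ ∏ i, c i := by
    intro σ _
    have h1 : |Equiv.Perm.sign σ • ∏ i, M.transpose (σ i) i| = ∏ i, |M i (σ i)| := by
      rcases Int.units_eq_one_or (Equiv.Perm.sign σ) with h | h <;>
        simp [h, Finset.abs_prod]
    rw [h1]
    exact Finset.prod_le_prod (fun i _ => abs_nonneg _) fun i _ => h i _
  refine (Finset.sum_le_sum this).trans ?_
  simp [Finset.card_univ, Fintype.card_perm]

/-- Row operations clearing the first column below the diagonal: a bound for a determinant in terms
of the quality of auxiliary vectors `x k`, each a combination of the first `k + 1` rows. -/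
theorem Matrix.abs_det_le_of_sum_smul {d : ℕ} (M : Matrix (Fin (d + 1)) (Fin (d + 1)) ℝ)
    (x : Fin d → Fin (d + 1) → ℝ) (c : Fin d → ℝ)
    (f : Fin d → Fin (d + 1) → ℝ) (hf : ∀ k j, k.succ ≤ j → f k j = 0)
    (hfx : ∀ k, x k = ∑ j, f k j • M j) (hx0 : ∀ k, x k 0 ≠ 0)
    (hc : ∀ k j : Fin d, |M k.succ j.succ - M k.succ 0 / x k 0 * x k j.succ| ≤ c k) :
    |M.det| ≤ |M 0 0| * (d.factorial * ∏ k, c k) := by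
  let N : Matrix (Fin (d + 1)) (Fin (d + 1)) ℝ :=
    Matrix.of (Fin.cons (Pi.single 0 1)
      fun k => Pi.single k.succ 1 - (M k.succ 0 / x k 0) • f k)
  have hN : N.det = 1 := by
    rw [Matrix.det_of_isLowerTriangular]
    · refine Finset.prod_eq_one fun i _ => ?_
      refine Fin.cases ?_ (fun k => ?_) i
      · simp [N]
      · simp [N, hf k k.succ le_rfl]
    · intro i j hij
      have hij : i < j := hij
      revert hij
      refine Fin.cases ?_ (fun k => ?_) i
      · intro h
        simp [N, h.ne']
      · intro h
        simp [N, h.ne', hf k j h.le]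
  have hdet : M.det = (N * M).det := by rw [Matrix.det_mul, hN, one_mul]
  have hrow0 : ∀ j, (N * M) 0 j = M 0 j := by
    intro j
    simp [Matrix.mul_apply, N, Pi.single_apply]
  have hrow : ∀ (k : Fin d) j, (N * M) k.succ j = M k.succ j - M k.succ 0 / x k 0 * x k j := by
    intro k j
    have h1 : x k j = ∑ i, f k i * M i j := by
      conv_lhs => rw [hfx k]
      simp [Finset.sum_apply]
    rw [h1, Finset.mul_sum]
    simp [Matrix.mul_apply, N, Pi.single_apply, sub_mul, Finset.sum_sub_distrib, mul_assoc]
  rw [hdet, Matrix.det_succ_column_zero, Fin.sum_univ_succ]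
  have hz : ∀ k : Fin d, (N * M) k.succ 0 = 0 := by
    intro k
    rw [hrow, div_mul_cancel₀ _ (hx0 k), sub_self]
  simp only [hz, mul_zero, zero_mul, Finset.sum_const_zero, add_zero, hrow0]
  rw [abs_mul]
  simp only [Fin.val_zero, pow_zero, one_mul]
  refine mul_le_mul_of_nonneg_left (Matrix.abs_det_le_prod _ c fun i j => ?_) (abs_nonneg _)
  simp only [Matrix.submatrix_apply, Fin.succAbove_zero, hrow]
  exact hc i j

/-- For integer vectors `m i` that span `ℚ ^ (d + 1)`, seen through the real coordinates
`p i = m i ᵥ* T`, whose first coordinate grows in absolute value and whose other coordinates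
decrease, there are `d` steps at which the product of the quantities on the right is bounded
below. -/
theorem exists_steps_le_prod {d : ℕ} (m : ℕ → Fin (d + 1) → ℤ)
    (hm : ∀ f : (Fin (d + 1) → ℚ) →ₗ[ℚ] ℚ, (∀ i, f (fun j => (m i j : ℚ)) = 0) → f = 0)
    (T : Matrix (Fin (d + 1)) (Fin (d + 1)) ℝ) (a b : ℕ → ℝ) (p : ℕ → Fin (d + 1) → ℝ)
    (hp : ∀ i, p i = Matrix.vecMul (fun j => (m i j : ℝ)) T) (ha : ∀ i, a i = |p i 0|)
    (hapos : ∀ i, 0 < a i) (hmono : Monotone a) (hb : ∀ i (j : Fin d), |p i j.succ| ≤ b i)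
    (hanti : Antitone b) (hbpos : ∀ i, 0 < b i) :
    ∃ σ : ℕ → ℕ, (∀ k, k + 1 < d → σ k + 1 ≤ σ (k + 1)) ∧ (∀ k < d, m (σ k + 1) ≠ m (σ k)) ∧
      |T.det| ≤ a 0 *
        (d.factorial * ∏ k ∈ Finset.range d, (2 * b (σ k) * a (σ k + 1) / a (σ k))) := by
  set q : ℕ → Fin (d + 1) → ℚ := fun i j => (m i j : ℚ) with hq
  have hdim : Module.finrank ℚ (Fin (d + 1) → ℚ) = d + 1 := by simp
  have h0 : q 0 ≠ 0 := by
    intro h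
    have h1 : ∀ j, m 0 j = 0 := fun j => by
      have := congrFun h j
      simpa [hq] using this
    have h2 := hapos 0
    rw [ha, hp] at h2
    simp [Matrix.vecMul, dotProduct, h1] at h2
  set τ : ℕ → ℕ := greedyIndex ℚ q with hτ
  have hτ0 : τ 0 = 0 := greedyIndex_zero h0
  have hlt : ∀ k < d, τ k < τ (k + 1) := fun k hk =>
    greedyIndex_lt_succ hm (by rw [hdim]; omega)
  have hσ : ∀ k < d, τ (k + 1) - 1 + 1 = τ (k + 1) := fun k hk => by
    have := hlt k hk
    omega
  have hmem : ∀ k < d, q (τ (k + 1) - 1) ∈ greedySpan (K := ℚ) q (k + 1) := fun k hk =>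
    mem_greedySpan_of_lt (by have := hσ k hk; change τ (k + 1) - 1 < τ (k + 1); omega)
  have hcoef : ∀ k : Fin d, ∃ f : Fin (d + 1) → ℚ, (∀ j, k.succ ≤ j → f j = 0) ∧
      q (τ (k + 1) - 1) = ∑ j : Fin (d + 1), f j • q (τ j) := by
    intro k
    have h1 := hmem k k.2
    rw [greedySpan_eq_span, Submodule.mem_span_range_iff_exists_fun] at h1
    obtain ⟨c, hc⟩ := h1
    refine ⟨fun j => if h : (j : ℕ) < k + 1 then c ⟨j, h⟩ else 0, fun j hj => ?_, ?_⟩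
    · have : (k : ℕ) + 1 ≤ j := by simpa [Fin.le_def] using hj
      exact dif_neg (by omega)
    · rw [← hc]
      symm
      have hk : (k : ℕ) + 1 ≤ d + 1 := by omega
      refine Finset.sum_of_injOn (e := fun i : Fin (k + 1) => Fin.castLE hk i) ?_ ?_ ?_ ?_ |>.symm
      · intro x _ y _ h
        simpa using h
      · intro x _
        simp
      · intro i _ hi
        have : ¬ (i : ℕ) < k + 1 := by
          intro h
          exact hi ⟨⟨i, h⟩, by simp, by ext; simp⟩
        simp [this]
      · intro i _
        have hi : ((Fin.castLE hk i : Fin (d + 1)) : ℕ) < k + 1 := i.2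
        simp only
        rw [dif_pos hi]
        rfl
  choose f hf hfx using hcoef
  set M : Matrix (Fin (d + 1)) (Fin (d + 1)) ℤ := Matrix.of fun j => m (τ j) with hM
  have hMdet : M.det ≠ 0 := by
    have h1 : LinearIndependent ℚ (M.map (Int.cast : ℤ → ℚ)).row :=
      linearIndependent_greedy (K := ℚ) (q := q) hm (k := d + 1) hdim.ge
    have h2 := Matrix.linearIndependent_rows_iff_isUnit.1 h1
    rw [Matrix.isUnit_iff_isUnit_det, isUnit_iff_ne_zero] at h2
    intro h
    apply h2
    have := (Int.castRingHom ℚ).map_det M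
    rw [h] at this
    simpa using this.symm
  set P : Matrix (Fin (d + 1)) (Fin (d + 1)) ℝ := Matrix.of fun j => p (τ j) with hP
  have hPM : P = M.map (Int.cast : ℤ → ℝ) * T := by
    ext i j
    simp [hP, hp, hM, Matrix.vecMul, dotProduct, Matrix.mul_apply]
  have hdet : |T.det| ≤ |P.det| := by
    have h1 : (M.map (Int.cast : ℤ → ℝ)).det = (M.det : ℝ) := by
      simpa using ((Int.castRingHom ℝ).map_det M).symm
    rw [hPM, Matrix.det_mul, abs_mul, h1]
    refine le_mul_of_one_le_left (abs_nonneg _) ?_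
    exact_mod_cast Int.one_le_abs hMdet
  have hne0 : ∀ i, p i 0 ≠ 0 := fun i => abs_pos.1 (ha i ▸ hapos i)
  refine ⟨fun k => τ (k + 1) - 1, fun k hk => ?_, fun k hk h => ?_, hdet.trans ?_⟩
  · have := hlt (k + 1) hk
    have := hσ k (by omega)
    simp only
    omega
  · have h1 := hmem k hk
    have h2 : q (τ (k + 1) - 1 + 1) = q (τ (k + 1) - 1) := by
      simp only at h
      simp only [hq, h]
    rw [← h2, hσ k hk] at h1
    exact greedyIndex_notMem hm (by rw [hdim]; omega) h1
  · have h1 := Matrix.abs_det_le_of_sum_smul P (fun k => p (τ (k + 1) - 1))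
      (fun k : Fin d => 2 * b (τ (k + 1) - 1) * a (τ (k + 1) - 1 + 1) / a (τ (k + 1) - 1))
      (fun k j => (f k j : ℝ)) (fun k j h => by simp [hf k j h]) (fun k => ?_)
      (fun k => hne0 _) (fun k j => ?_)
    · have h2 : |P 0 0| = a 0 := by simp [hP, hτ0, ha]
      rw [h2] at h1
      rwa [Finset.prod_range fun k =>
        2 * b (τ (k + 1) - 1) * a (τ (k + 1) - 1 + 1) / a (τ (k + 1) - 1)]
    · have h3 : ∀ l, (m (τ (k + 1) - 1) l : ℝ) = ∑ j : Fin (d + 1), (f k j : ℝ) * m (τ j) l := by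
        intro l
        have := congrFun (hfx k) l
        simp only [hq, Finset.sum_apply, Pi.smul_apply, smul_eq_mul] at this
        exact_mod_cast this
      ext l
      simp only [hp, Matrix.vecMul, dotProduct, hP, Finset.sum_apply, Pi.smul_apply, smul_eq_mul,
        Matrix.of_apply, h3, Finset.sum_mul, Finset.mul_sum]
      rw [Finset.sum_comm]
      simp only [mul_assoc]
    · set s := τ (k + 1) - 1 with hs
      have h4 : P k.succ = p (s + 1) := by
        rw [hs, hσ k k.2]
        rfl
      rw [h4]
      have h5 : |p (s + 1) 0 / p s 0 * p s j.succ| ≤ a (s + 1) / a s * b s := by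
        rw [abs_mul, abs_div, ← ha, ← ha]
        exact mul_le_mul_of_nonneg_left (hb s j) (div_pos (hapos _) (hapos _)).le
      have h6 : 1 ≤ a (s + 1) / a s := (one_le_div (hapos _)).2 (hmono (Nat.le_succ s))
      have h7 : b s ≤ a (s + 1) / a s * b s := le_mul_of_one_le_left (hbpos s).le h6
      calc _ ≤ |p (s + 1) j.succ| + |p (s + 1) 0 / p s 0 * p s j.succ| := abs_sub _ _
        _ ≤ b s + a (s + 1) / a s * b s :=
          add_le_add ((hb _ _).trans (hanti (Nat.le_succ s))) h5
        _ ≤ a (s + 1) / a s * b s + a (s + 1) / a s * b s := by linarith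
        _ = 2 * b s * a (s + 1) / a s := by ring

/-- Logarithmic form of `exists_steps_le_prod`. -/
theorem exists_steps_log_le {d : ℕ} (m : ℕ → Fin (d + 1) → ℤ)
    (hm : ∀ f : (Fin (d + 1) → ℚ) →ₗ[ℚ] ℚ, (∀ i, f (fun j => (m i j : ℚ)) = 0) → f = 0)
    (T : Matrix (Fin (d + 1)) (Fin (d + 1)) ℝ) (hT : T.det ≠ 0) (a b : ℕ → ℝ)
    (p : ℕ → Fin (d + 1) → ℝ)
    (hp : ∀ i, p i = Matrix.vecMul (fun j => (m i j : ℝ)) T) (ha : ∀ i, a i = |p i 0|)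
    (hapos : ∀ i, 0 < a i) (hmono : Monotone a) (hb : ∀ i (j : Fin d), |p i j.succ| ≤ b i)
    (hanti : Antitone b) (hbpos : ∀ i, 0 < b i) :
    ∃ σ : ℕ → ℕ, (∀ k, k + 1 < d → σ k + 1 ≤ σ (k + 1)) ∧ (∀ k < d, m (σ k + 1) ≠ m (σ k)) ∧
      0 ≤ Real.log (d.factorial * 2 ^ d / |T.det|) + Real.log (a 0) +
        ∑ k ∈ Finset.range d,
          (Real.log (b (σ k)) + Real.log (a (σ k + 1)) - Real.log (a (σ k))) := by
  obtain ⟨σ, h1, h2, h3⟩ := exists_steps_le_prod m hm T a b p hp ha hapos hmono hb hanti hbpos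
  refine ⟨σ, h1, h2, ?_⟩
  have hT' : 0 < |T.det| := abs_pos.2 hT
  have hf : (0 : ℝ) < d.factorial := by exact_mod_cast d.factorial_pos
  have h4 := Real.log_le_log hT' h3
  have hpos : ∀ k ∈ Finset.range d, 2 * b (σ k) * a (σ k + 1) / a (σ k) ≠ 0 := fun k _ =>
    (div_pos (mul_pos (mul_pos two_pos (hbpos _)) (hapos _)) (hapos _)).ne'
  rw [Real.log_mul (hapos 0).ne' (mul_ne_zero hf.ne' (Finset.prod_ne_zero_iff.2 hpos)),
    Real.log_mul hf.ne' (Finset.prod_ne_zero_iff.2 hpos), Real.log_prod hpos] at h4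
  have h5 : ∑ k ∈ Finset.range d, Real.log (2 * b (σ k) * a (σ k + 1) / a (σ k)) =
      d * Real.log 2 + ∑ k ∈ Finset.range d,
          (Real.log (b (σ k)) + Real.log (a (σ k + 1)) - Real.log (a (σ k))) := by
    rw [← Finset.card_range d, ← nsmul_eq_mul, ← Finset.sum_const, Finset.card_range,
      ← Finset.sum_add_distrib]
    refine Finset.sum_congr rfl fun k _ => ?_
    rw [Real.log_div (mul_pos (mul_pos two_pos (hbpos _)) (hapos _)).ne' (hapos _).ne',
      Real.log_mul (mul_pos two_pos (hbpos _)).ne' (hapos _).ne',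
      Real.log_mul two_ne_zero (hbpos _).ne']
    ring
  rw [Real.log_div (by positivity) hT'.ne', Real.log_mul hf.ne' (by positivity), Real.log_pow]
  linarith

/-- The geometric sum `1 + r + ... + r ^ (m - 1)`. -/
noncomputable def geo (r : ℝ) (m : ℕ) : ℝ := ∑ i ∈ Finset.range m, r ^ i

theorem geo_zero (r : ℝ) : geo r 0 = 0 := by simp [geo]

theorem geo_succ (r : ℝ) (m : ℕ) : geo r (m + 1) = geo r m + r ^ m := Finset.sum_range_succ _ _

theorem geo_add (r : ℝ) (a b : ℕ) : geo r (a + b) = geo r a + r ^ a * geo r b := by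
  simp [geo, Finset.sum_range_add, pow_add, Finset.mul_sum]

theorem geo_succ' (r : ℝ) (m : ℕ) : geo r (m + 1) = 1 + r * geo r m := by
  rw [add_comm m 1, geo_add]
  simp [geo]

theorem geo_nonneg {r : ℝ} (hr : 0 ≤ r) (m : ℕ) : 0 ≤ geo r m :=
  Finset.sum_nonneg fun _ _ => pow_nonneg hr _

theorem geo_succ_pos {r : ℝ} (hr : 0 ≤ r) (m : ℕ) : 0 < geo r (m + 1) := by
  rw [geo_succ']
  have := mul_nonneg hr (geo_nonneg hr m)
  linarith

theorem geo_mul (r : ℝ) (m : ℕ) : geo r m * (r - 1) = r ^ m - 1 := geom_sum_mul r m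

/-- The extremal inequality behind the exponents' ratios: it is an equality for geometric
progressions of ratio `r`. -/
theorem geo_mul_sum_le {r : ℝ} (hr : 0 < r) (e : ℕ) (y z : ℕ → ℝ) (h1 : ∀ k < e, y k ≤ z (k + 1))
    (h2 : ∀ k < e, y (k + 1) ≤ r * z (k + 1)) :
    geo r e * ∑ k ∈ Finset.range (e + 1), y k ≤
      geo r (e + 1) * ∑ k ∈ Finset.range e, z (k + 1) := by
  have key : ∀ k ∈ Finset.range e,
      geo r (e - k) * y k + r ^ (e - (k + 1)) * geo r (k + 1) * y (k + 1) ≤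
        geo r (e + 1) * z (k + 1) := by
    intro k hk
    have hk : k < e := Finset.mem_range.1 hk
    have h3 : geo r (e + 1) = geo r (e - k) + r ^ (e - (k + 1)) * geo r (k + 1) * r := by
      rw [show e + 1 = (e - k) + (k + 1) by omega, geo_add,
        show e - k = e - (k + 1) + 1 by omega, pow_succ]
      ring
    rw [h3, add_mul]
    refine add_le_add (mul_le_mul_of_nonneg_left (h1 k hk) (geo_nonneg hr.le _)) ?_
    rw [mul_assoc _ r]
    exact mul_le_mul_of_nonneg_left (h2 k hk)
      (mul_nonneg (pow_nonneg hr.le _) (geo_nonneg hr.le _))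
  have h4 := Finset.sum_le_sum key
  rw [← Finset.mul_sum, Finset.sum_add_distrib] at h4
  refine le_trans (le_of_eq ?_) h4
  have h5 : ∑ k ∈ Finset.range e, geo r (e - k) * y k =
      ∑ k ∈ Finset.range (e + 1), geo r (e - k) * y k := by
    rw [Finset.sum_range_succ]
    simp [geo_zero]
  have h6 : ∑ k ∈ Finset.range e, r ^ (e - (k + 1)) * geo r (k + 1) * y (k + 1) =
      ∑ k ∈ Finset.range (e + 1), r ^ (e - k) * geo r k * y k := by
    rw [Finset.sum_range_succ']
    simp [geo_zero]
  rw [h5, h6, ← Finset.sum_add_distrib, Finset.mul_sum]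
  refine Finset.sum_congr rfl fun k hk => ?_
  have hk : k ≤ e := by
    have := Finset.mem_range.1 hk
    omega
  rw [← add_mul, ← geo_add, Nat.sub_add_cancel hk]

/-- The combination of `exists_steps_log_le` with `geo_mul_sum_le`. -/
theorem exists_steps_geo {e : ℕ} (m : ℕ → Fin (e + 1 + 1) → ℤ)
    (hm : ∀ f : (Fin (e + 1 + 1) → ℚ) →ₗ[ℚ] ℚ, (∀ i, f (fun j => (m i j : ℚ)) = 0) → f = 0)
    (T : Matrix (Fin (e + 1 + 1)) (Fin (e + 1 + 1)) ℝ) (hT : T.det ≠ 0) (a b : ℕ → ℝ)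
    (p : ℕ → Fin (e + 1 + 1) → ℝ)
    (hp : ∀ i, p i = Matrix.vecMul (fun j => (m i j : ℝ)) T) (ha : ∀ i, a i = |p i 0|)
    (hapos : ∀ i, 0 < a i) (hmono : Monotone a) (hb : ∀ i (j : Fin (e + 1)), |p i j.succ| ≤ b i)
    (hanti : Antitone b) (hbpos : ∀ i, 0 < b i) {κ r : ℝ} (hr : 0 < r)
    (hκ : ∀ i, m (i + 1) ≠ m i → Real.log (b i) ≤ -κ * Real.log (a (i + 1)))
    (har : ∀ i, m (i + 1) ≠ m i → Real.log (a (i + 1)) ≤ r * Real.log (a i)) :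
    ∃ σ : ℕ → ℕ, m (σ 0 + 1) ≠ m (σ 0) ∧
      0 ≤ geo r (e + 1) * (Real.log ((e + 1).factorial * 2 ^ (e + 1) / |T.det|) + Real.log (a 0) -
          Real.log (a (σ 0))) +
        ((1 - κ) * geo r (e + 1) - geo r e) *
          ∑ k ∈ Finset.range (e + 1), Real.log (a (σ k + 1)) := by
  obtain ⟨σ, h1, h2, h3⟩ := exists_steps_log_le m hm T hT a b p hp ha hapos hmono hb hanti hbpos
  refine ⟨σ, h2 0 (Nat.succ_pos e), ?_⟩
  have h4 := geo_mul_sum_le hr e (fun k => Real.log (a (σ k + 1))) (fun k => Real.log (a (σ k)))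
    (fun k hk => Real.log_le_log (hapos _) (hmono (h1 k (by omega))))
    (fun k hk => har _ (h2 _ (by omega)))
  have h5 : ∑ k ∈ Finset.range (e + 1),
      (Real.log (b (σ k)) + Real.log (a (σ k + 1)) - Real.log (a (σ k))) ≤
      (1 - κ) * ∑ k ∈ Finset.range (e + 1), Real.log (a (σ k + 1)) -
        ∑ k ∈ Finset.range (e + 1), Real.log (a (σ k)) := by
    rw [Finset.mul_sum, ← Finset.sum_sub_distrib]
    refine Finset.sum_le_sum fun k hk => ?_
    have := hκ _ (h2 k (Finset.mem_range.1 hk))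
    linarith
  rw [Finset.sum_range_succ' (fun k => Real.log (a (σ k)))] at h5
  have h6 := mul_nonneg (geo_nonneg hr.le (e + 1)) (h3.trans (add_le_add_right h5 _))
  linarith

section BestApproximations

variable {V : Type*} {N E : V → ℝ}

/-- For points `x` of size `N x` and error `E x`, the system `E x ≤ t ^ (-γ)`, `0 < N x ≤ t` has a
solution. -/
def Solvable (N E : V → ℝ) (γ t : ℝ) : Prop := ∃ x, E x ≤ t ^ (-γ) ∧ 0 < N x ∧ N x ≤ t

theorem exists_pos_le_error (hfin : ∀ Q : ℝ, {x | N x ≤ Q ∧ E x ≤ Q}.Finite)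
    (hpos : ∀ x, 0 < N x → 0 < E x) (Q : ℝ) :
    ∃ ε > 0, ∀ x, 0 < N x → N x ≤ Q → ε ≤ E x := by
  set s : Set V := {x | N x ≤ max Q 1 ∧ E x ≤ max Q 1} ∩ {x | 0 < N x} with hs
  have hsf : s.Finite := (hfin _).inter_of_left _
  rcases s.eq_empty_or_nonempty with h | h
  · refine ⟨1, one_pos, fun x hx hxQ => ?_⟩
    by_contra! hE
    have : x ∈ s := ⟨⟨hxQ.trans (le_max_left _ _), hE.le.trans (le_max_right _ _)⟩, hx⟩
    rw [h] at this
    exact this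
  · obtain ⟨x₀, hx₀, hmin⟩ := Set.exists_min_image s E hsf h
    refine ⟨min 1 (E x₀), lt_min one_pos (hpos _ hx₀.2), fun x hx hxQ => ?_⟩
    by_contra! hE
    have h1 := hE.trans_le (min_le_left _ _)
    have : x ∈ s := ⟨⟨hxQ.trans (le_max_left _ _), h1.le.trans (le_max_right _ _)⟩, hx⟩
    exact absurd (hmin x this) (not_le.2 (hE.trans_le (min_le_right _ _)))

/-- Frequent solvability yields approximations of arbitrarily large size. -/
theorem exists_large_of_frequently (hfin : ∀ Q : ℝ, {x | N x ≤ Q ∧ E x ≤ Q}.Finite)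
    (hpos : ∀ x, 0 < N x → 0 < E x) {γ : ℝ} (hγ : 0 < γ)
    (h : ∃ᶠ t in atTop, Solvable N E γ t) (Q : ℝ) :
    ∃ x, Q < N x ∧ 0 < N x ∧ E x ≤ N x ^ (-γ) := by
  obtain ⟨ε, hε, hmin⟩ := exists_pos_le_error hfin hpos Q
  have h1 : ∀ᶠ t : ℝ in atTop, t ^ (-γ) < ε :=
    (tendsto_rpow_neg_atTop hγ).eventually (gt_mem_nhds hε)
  obtain ⟨t, ⟨x, hx1, hx2, hx3⟩, ht⟩ := (h.and_eventually h1).exists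
  refine ⟨x, ?_, hx2, hx1.trans (Real.rpow_le_rpow_of_nonpos hx2 hx3 (by linarith))⟩
  by_contra! hQ
  exact absurd (hmin x hx2 hQ) (not_le.2 (hx1.trans_lt ht))

theorem exists_best (hfin : ∀ Q : ℝ, {x | N x ≤ Q ∧ E x ≤ Q}.Finite) {γ Q : ℝ}
    (h : Solvable N E γ Q) :
    ∃ u, 0 < N u ∧ N u ≤ Q ∧
      ∀ x, 0 < N x → N x ≤ Q → E u < E x ∨ E u = E x ∧ N u ≤ N x := by
  obtain ⟨x₀, h1, h2, h3⟩ := h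
  set M := max Q (Q ^ (-γ)) with hM
  set s : Set V := {x | N x ≤ M ∧ E x ≤ M} ∩ {x | 0 < N x ∧ N x ≤ Q} with hs
  obtain ⟨u, hu, hmin⟩ := Set.exists_min_image s (fun x => toLex (E x, N x))
    ((hfin _).inter_of_left _)
    ⟨x₀, ⟨h3.trans (le_max_left _ _), h1.trans (le_max_right _ _)⟩, h2, h3⟩
  refine ⟨u, hu.2.1, hu.2.2, fun x hx hxQ => ?_⟩
  by_cases hE : E x ≤ M
  · have := hmin x ⟨⟨hxQ.trans (le_max_left _ _), hE⟩, hx, hxQ⟩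
    simpa [Prod.Lex.toLex_le_toLex] using this
  · exact Or.inl (hu.1.2.trans_lt (not_le.1 hE))

/-- A sequence of best approximations. -/
theorem exists_best_sequence (hfin : ∀ Q : ℝ, {x | N x ≤ Q ∧ E x ≤ Q}.Finite)
    (hpos : ∀ x, 0 < N x → 0 < E x) (hint : ∀ x, ∃ k : ℕ, N x = k) {γ : ℝ} (hγ : 0 < γ)
    (h : ∀ᶠ t in atTop, Solvable N E γ t) :
    ∃ u : ℕ → V, (∀ i, 0 < N (u i)) ∧ Monotone (N ∘ u) ∧ Antitone (E ∘ u) ∧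
      (∀ i, E (u i) ≤ N (u (i + 1)) ^ (-γ)) ∧ Tendsto (N ∘ u) atTop atTop ∧
      Tendsto (E ∘ u) atTop (𝓝 0) := by
  obtain ⟨T₀, hT₀⟩ := eventually_atTop.1 h
  obtain ⟨T, hT⟩ := exists_nat_ge (max T₀ 1)
  have hT1 : (1 : ℝ) ≤ T := (le_max_right _ _).trans hT
  have hsol : ∀ t : ℝ, T ≤ t → Solvable N E γ t := fun t ht =>
    hT₀ t ((le_max_left _ _).trans (hT.trans ht))
  have hex : ∀ i : ℕ, ∃ u, 0 < N u ∧ N u ≤ (T + i : ℕ) ∧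
      ∀ x, 0 < N x → N x ≤ (T + i : ℕ) → E u < E x ∨ E u = E x ∧ N u ≤ N x := fun i =>
    exists_best hfin (hsol _ (by push_cast; linarith [(Nat.cast_nonneg i : (0 : ℝ) ≤ i)]))
  choose u hu0 huQ hmin using hex
  have hE : ∀ i x, 0 < N x → N x ≤ (T + i : ℕ) → E (u i) ≤ E x := fun i x h1 h2 =>
    (hmin i x h1 h2).elim le_of_lt fun h => h.1.le
  have hcast : ∀ {i j : ℕ}, i ≤ j → ((T + i : ℕ) : ℝ) ≤ (T + j : ℕ) := fun h => by
    exact_mod_cast Nat.add_le_add_left h T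
  have hdecay : ∀ i, E (u i) ≤ ((T + (i + 1) : ℕ) : ℝ) ^ (-γ) := by
    intro i
    have hpos' : (0 : ℝ) < (T + (i + 1) : ℕ) := by
      push_cast
      linarith [(Nat.cast_nonneg i : (0 : ℝ) ≤ i)]
    have hcont : Tendsto (fun t : ℝ => t ^ (-γ)) (𝓝[<] ((T + (i + 1) : ℕ) : ℝ))
        (𝓝 (((T + (i + 1) : ℕ) : ℝ) ^ (-γ))) :=
      (Real.continuousAt_rpow_const _ _ (Or.inl hpos'.ne')).tendsto.mono_left nhdsWithin_le_nhds
    refine ge_of_tendsto hcont ?_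
    have hlt : ((T + i : ℕ) : ℝ) < (T + (i + 1) : ℕ) := by
      exact_mod_cast Nat.lt_succ_self (T + i)
    filter_upwards [Ico_mem_nhdsLT hlt] with t ht
    obtain ⟨x, hx1, hx2, hx3⟩ := hsol t
      (le_trans (by push_cast; linarith [(Nat.cast_nonneg i : (0 : ℝ) ≤ i)]) ht.1)
    refine (hE i x hx2 ?_).trans hx1
    obtain ⟨k, hk⟩ := hint x
    rw [hk] at hx3 ⊢
    have : k < T + (i + 1) := by exact_mod_cast hx3.trans_lt ht.2
    exact_mod_cast (by omega : k ≤ T + i)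
  have hE0 : Tendsto (E ∘ u) atTop (𝓝 0) := by
    refine squeeze_zero (fun i => (hpos _ (hu0 i)).le) hdecay ?_
    refine (tendsto_rpow_neg_atTop hγ).comp (tendsto_natCast_atTop_atTop.comp ?_)
    exact tendsto_atTop_mono (fun i => (by omega : i ≤ T + (i + 1))) tendsto_id
  refine ⟨u, hu0, ?_, ?_, fun i => (hdecay i).trans ?_, ?_, hE0⟩
  · intro i j hij
    simp only [Function.comp_apply]
    by_cases hN : N (u j) ≤ (T + i : ℕ)
    · rcases hmin i (u j) (hu0 j) hN with h1 | h1
      · exact absurd (hE j (u i) (hu0 i) ((huQ i).trans (hcast hij))) (not_le.2 h1)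
      · exact h1.2
    · exact (huQ i).trans (not_le.1 hN).le
  · intro i j hij
    exact hE j (u i) (hu0 i) ((huQ i).trans (hcast hij))
  · exact Real.rpow_le_rpow_of_nonpos (hu0 _) (huQ _) (by linarith)
  · refine tendsto_atTop.2 fun B => ?_
    obtain ⟨ε, hε, hB⟩ := exists_pos_le_error hfin hpos B
    filter_upwards [hE0.eventually (gt_mem_nhds hε)] with i hi
    by_contra! hNB
    exact absurd (hB (u i) (hu0 i) hNB.le) (not_le.2 hi)

end BestApproximations

section Points

variable {n : ℕ} {θ : Fin n → ℝ}

theorem eq_zero_of_linearForm_eq_zero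
    (hθ : LinearIndependent ℚ (Fin.cons 1 θ : Fin (n + 1) → ℝ)) (c : Fin (n + 1) → ℚ)
    (h : (c 0 : ℝ) + ∑ i : Fin n, θ i * (c i.succ : ℝ) = 0) : c = 0 := by
  have := Fintype.linearIndependent_iff.1 hθ c (by
    rw [Fin.sum_univ_succ]
    simpa [Rat.smul_def, mul_comm] using h)
  exact funext this

/-- The size `|x₀|` in simultaneous approximation. -/
def simSize (x : Fin (n + 1) → ℤ) : ℝ := ((x 0).natAbs : ℕ)

/-- The error of simultaneous approximation. -/
noncomputable def simError (θ : Fin n → ℝ) (x : Fin (n + 1) → ℤ) : ℝ :=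
  ‖fun i : Fin n => (x 0 : ℝ) * θ i - (x i.succ : ℝ)‖

/-- The size `max |x_i|` of a linear form. -/
def linSize (x : Fin (n + 1) → ℤ) : ℝ :=
  (Finset.univ.sup (fun i : Fin n => (x i.succ).natAbs) : ℕ)

/-- The value of the linear form with coefficients `1, θ_1, ..., θ_n`. -/
noncomputable def linForm (θ : Fin n → ℝ) : (Fin (n + 1) → ℤ) →ₗ[ℤ] ℝ :=
  Fintype.linearCombination ℤ (Fin.cons 1 θ : Fin (n + 1) → ℝ)

theorem linForm_apply (x : Fin (n + 1) → ℤ) :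
    linForm θ x = (x 0 : ℝ) + ∑ i : Fin n, θ i * (x i.succ : ℝ) := by
  simp [linForm, Fintype.linearCombination_apply, Fin.sum_univ_succ, mul_comm]

theorem linForm_ne_zero (hθ : LinearIndependent ℚ (Fin.cons 1 θ : Fin (n + 1) → ℝ))
    {x : Fin (n + 1) → ℤ} (hx : x ≠ 0) : linForm θ x ≠ 0 := by
  intro h
  apply hx
  have := eq_zero_of_linearForm_eq_zero hθ (fun i => (x i : ℚ)) (by
    rw [linForm_apply] at h
    exact_mod_cast h)
  ext i
  have := congrFun this i
  simpa using this

theorem simSize_eq (x : Fin (n + 1) → ℤ) : simSize x = |(x 0 : ℝ)| := by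
  simp [simSize, Nat.cast_natAbs]

theorem le_linSize (x : Fin (n + 1) → ℤ) (i : Fin n) : |(x i.succ : ℝ)| ≤ linSize x := by
  have : (x i.succ).natAbs ≤ Finset.univ.sup (fun i : Fin n => (x i.succ).natAbs) :=
    Finset.le_sup (f := fun i : Fin n => (x i.succ).natAbs) (Finset.mem_univ i)
  calc |(x i.succ : ℝ)| = ((x i.succ).natAbs : ℝ) := by simp [Nat.cast_natAbs]
    _ ≤ _ := Nat.cast_le.2 this

theorem linSize_le_iff {x : Fin (n + 1) → ℤ} {t : ℝ} (ht : 0 ≤ t) :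
    linSize x ≤ t ↔ ∀ i : Fin n, |(x i.succ : ℝ)| ≤ t := by
  refine ⟨fun h i => (le_linSize x i).trans h, fun h => ?_⟩
  rw [linSize, ← Nat.le_floor_iff ht, Finset.sup_le_iff]
  intro i _
  rw [Nat.le_floor_iff ht]
  simpa [Nat.cast_natAbs] using h i

theorem linSize_pos_iff {x : Fin (n + 1) → ℤ} :
    0 < linSize x ↔ ∃ i : Fin n, 0 < |(x i.succ : ℝ)| := by
  constructor
  · intro h
    by_contra! hn
    exact absurd ((linSize_le_iff le_rfl).2 hn) (not_le.2 h)
  · rintro ⟨i, hi⟩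
    exact hi.trans_le (le_linSize x i)

theorem simSolvable_iff {γ t : ℝ} (ht : 0 < t) :
    SimSolvable θ γ t ↔ Solvable simSize (simError θ) γ t := by
  refine exists_congr fun x => ?_
  rw [simSize_eq, simError, pi_norm_le_iff_of_nonneg (Real.rpow_nonneg ht.le _)]
  rfl

theorem linSolvable_iff {γ t : ℝ} (ht : 0 < t) :
    LinSolvable θ γ t ↔ Solvable linSize (fun x => |linForm θ x|) γ t := by
  refine exists_congr fun x => ?_
  simp only [linSize_pos_iff, linSize_le_iff ht.le, linForm_apply]

theorem eventually_simSolvable_iff {γ : ℝ} : (∀ᶠ t in atTop, SimSolvable θ γ t) ↔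
    ∀ᶠ t in atTop, Solvable simSize (simError θ) γ t :=
  eventually_congr ((eventually_gt_atTop 0).mono fun _ ht => simSolvable_iff ht)

theorem eventually_linSolvable_iff {γ : ℝ} : (∀ᶠ t in atTop, LinSolvable θ γ t) ↔
    ∀ᶠ t in atTop, Solvable linSize (fun x => |linForm θ x|) γ t :=
  eventually_congr ((eventually_gt_atTop 0).mono fun _ ht => linSolvable_iff ht)

theorem frequently_simSolvable_iff {γ : ℝ} : (∃ᶠ t in atTop, SimSolvable θ γ t) ↔
    ∃ᶠ t in atTop, Solvable simSize (simError θ) γ t :=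
  frequently_congr ((eventually_gt_atTop 0).mono fun _ ht => simSolvable_iff ht)

theorem frequently_linSolvable_iff {γ : ℝ} : (∃ᶠ t in atTop, LinSolvable θ γ t) ↔
    ∃ᶠ t in atTop, Solvable linSize (fun x => |linForm θ x|) γ t :=
  frequently_congr ((eventually_gt_atTop 0).mono fun _ ht => linSolvable_iff ht)

theorem finite_int_box (B : ℝ) : {x : Fin (n + 1) → ℤ | ∀ i, |(x i : ℝ)| ≤ B}.Finite := by
  refine (Set.finite_Icc (fun _ => -⌈B⌉) (fun _ => ⌈B⌉)).subset fun x hx => ?_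
  have h : ∀ i, |x i| ≤ ⌈B⌉ := fun i => by
    have := (hx i).trans (Int.le_ceil B)
    exact_mod_cast this
  exact ⟨fun i => (abs_le.1 (h i)).1, fun i => (abs_le.1 (h i)).2⟩

theorem abs_le_simError (x : Fin (n + 1) → ℤ) (i : Fin n) :
    |(x 0 : ℝ) * θ i - (x i.succ : ℝ)| ≤ simError θ x :=
  norm_le_pi_norm (fun i : Fin n => (x 0 : ℝ) * θ i - (x i.succ : ℝ)) i

theorem finite_sim (Q : ℝ) :
    {x : Fin (n + 1) → ℤ | simSize x ≤ Q ∧ simError θ x ≤ Q}.Finite := by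
  refine (finite_int_box (Q * ∑ i, |θ i| + Q)).subset fun x hx i => ?_
  obtain ⟨h1, h2⟩ := hx
  rw [simSize_eq] at h1
  have hQ : 0 ≤ Q := (abs_nonneg _).trans h1
  have hS : 0 ≤ Q * ∑ i, |θ i| := mul_nonneg hQ (Finset.sum_nonneg fun _ _ => abs_nonneg _)
  refine Fin.cases (by linarith) (fun i => ?_) i
  have h3 : |(x 0 : ℝ) * θ i| ≤ Q * ∑ i, |θ i| := by
    rw [abs_mul]
    exact mul_le_mul h1 (Finset.single_le_sum (f := fun i => |θ i|) (fun _ _ => abs_nonneg _)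
      (Finset.mem_univ i)) (abs_nonneg _) hQ
  have h4 := (abs_le_simError (θ := θ) x i).trans h2
  calc |(x i.succ : ℝ)| = |(x 0 : ℝ) * θ i - ((x 0 : ℝ) * θ i - (x i.succ : ℝ))| := by
        congr 1
        ring
    _ ≤ |(x 0 : ℝ) * θ i| + |(x 0 : ℝ) * θ i - (x i.succ : ℝ)| := abs_sub _ _
    _ ≤ _ := add_le_add h3 h4

theorem abs_le_of_lin (x : Fin (n + 1) → ℤ) (i : Fin (n + 1)) :
    |(x i : ℝ)| ≤ |linForm θ x| + (1 + ∑ i, |θ i|) * linSize x := by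
  have hN : 0 ≤ linSize x := Nat.cast_nonneg _
  have hS : 0 ≤ ∑ i, |θ i| := Finset.sum_nonneg fun _ _ => abs_nonneg _
  refine Fin.cases ?_ (fun i => ?_) i
  · have h1 : (x 0 : ℝ) = linForm θ x - ∑ i : Fin n, θ i * (x i.succ : ℝ) := by
      rw [linForm_apply]
      ring
    have h2 : |∑ i : Fin n, θ i * (x i.succ : ℝ)| ≤ (∑ i, |θ i|) * linSize x := by
      rw [Finset.sum_mul]
      refine (Finset.abs_sum_le_sum_abs _ _).trans (Finset.sum_le_sum fun i _ => ?_)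
      rw [abs_mul]
      exact mul_le_mul_of_nonneg_left (le_linSize x i) (abs_nonneg _)
    rw [h1]
    refine (abs_sub _ _).trans ?_
    linarith
  · have h1 := le_linSize x i
    have h2 := mul_nonneg hS hN
    have := abs_nonneg (linForm θ x)
    linarith

theorem finite_lin (Q : ℝ) :
    {x : Fin (n + 1) → ℤ | linSize x ≤ Q ∧ |linForm θ x| ≤ Q}.Finite := by
  refine (finite_int_box (Q + (1 + ∑ i, |θ i|) * Q)).subset fun x hx i => ?_
  refine (abs_le_of_lin (θ := θ) x i).trans (add_le_add hx.2 (mul_le_mul_of_nonneg_left hx.1 ?_))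
  have hS : 0 ≤ ∑ i, |θ i| := Finset.sum_nonneg fun _ _ => abs_nonneg _
  linarith

theorem simError_pos (hθ : LinearIndependent ℚ (Fin.cons 1 θ : Fin (n + 1) → ℝ)) (hn : 0 < n)
    (x : Fin (n + 1) → ℤ) (hx : 0 < simSize x) : 0 < simError θ x := by
  refine lt_of_le_of_ne (norm_nonneg _) fun h => ?_
  have h1 := abs_le_simError (θ := θ) x ⟨0, hn⟩
  rw [← h] at h1
  have h2 := abs_nonpos_iff.1 h1
  have h3 := eq_zero_of_linearForm_eq_zero hθ
    (Fin.cons (-(x (Fin.succ ⟨0, hn⟩)) : ℚ) (Pi.single ⟨0, hn⟩ (x 0 : ℚ))) (by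
      simp only [Fin.cons_zero, Fin.cons_succ]
      rw [Finset.sum_eq_single ⟨0, hn⟩]
      · simp only [Pi.single_eq_same]
        push_cast
        linarith
      · intro i _ hi
        simp [hi]
      · simp)
  have h4 := congrFun h3 (Fin.succ ⟨0, hn⟩)
  rw [Fin.cons_succ, Pi.single_eq_same, Pi.zero_apply, Int.cast_eq_zero] at h4
  simp [simSize, h4] at hx

theorem linForm_pos (hθ : LinearIndependent ℚ (Fin.cons 1 θ : Fin (n + 1) → ℝ))
    (x : Fin (n + 1) → ℤ) (hx : 0 < linSize x) : 0 < |linForm θ x| := by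
  refine abs_pos.2 (linForm_ne_zero hθ fun h => ?_)
  obtain ⟨i, hi⟩ := linSize_pos_iff.1 hx
  simp [h] at hi

/-- Integer points approximating `θ` simultaneously span the whole space. -/
theorem sim_span (hθ : LinearIndependent ℚ (Fin.cons 1 θ : Fin (n + 1) → ℝ))
    (u : ℕ → Fin (n + 1) → ℤ) (hu : ∀ i, 1 ≤ simSize (u i))
    (hE : Tendsto (simError θ ∘ u) atTop (𝓝 0)) (f : (Fin (n + 1) → ℚ) →ₗ[ℚ] ℚ)
    (hf : ∀ i, f (fun j => (u i j : ℚ)) = 0) : f = 0 := by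
  set c : Fin (n + 1) → ℚ := fun j => f (Pi.single j 1) with hc
  have hfc : ∀ x, f x = ∑ j, x j * c j := fun x => by
    rw [LinearMap.pi_apply_eq_sum_univ f x]
    refine Finset.sum_congr rfl fun j _ => ?_
    rw [smul_eq_mul, hc]
    congr 2
    ext k
    simp [Pi.single_apply, eq_comm]
  have h1 : ∀ i, |(c 0 : ℝ) + ∑ j : Fin n, θ j * (c j.succ : ℝ)| ≤
      (∑ j : Fin n, |(c j.succ : ℝ)|) * simError θ (u i) := by
    intro i
    have h2 := hf i
    rw [hfc, Fin.sum_univ_succ] at h2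
    have h3 : (u i 0 : ℝ) * c 0 + ∑ j : Fin n, (u i j.succ : ℝ) * c j.succ = 0 := by
      exact_mod_cast h2
    have h4 : (u i 0 : ℝ) * ((c 0 : ℝ) + ∑ j : Fin n, θ j * (c j.succ : ℝ)) =
        ∑ j : Fin n, (c j.succ : ℝ) * ((u i 0 : ℝ) * θ j - u i j.succ) := by
      have h5 : ∑ j : Fin n, (c j.succ : ℝ) * ((u i 0 : ℝ) * θ j - u i j.succ) =
          (u i 0 : ℝ) * ∑ j : Fin n, θ j * (c j.succ : ℝ) -
            ∑ j : Fin n, (u i j.succ : ℝ) * c j.succ := by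
        rw [Finset.mul_sum, ← Finset.sum_sub_distrib]
        exact Finset.sum_congr rfl fun j _ => by ring
      rw [h5]
      linear_combination h3
    have h6 := hu i
    rw [simSize_eq] at h6
    calc _ ≤ |(u i 0 : ℝ)| * |(c 0 : ℝ) + ∑ j : Fin n, θ j * (c j.succ : ℝ)| :=
          le_mul_of_one_le_left (abs_nonneg _) h6
      _ = |∑ j : Fin n, (c j.succ : ℝ) * ((u i 0 : ℝ) * θ j - u i j.succ)| := by
          rw [← abs_mul, h4]
      _ ≤ _ := by
          rw [Finset.sum_mul]
          refine (Finset.abs_sum_le_sum_abs _ _).trans (Finset.sum_le_sum fun j _ => ?_)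
          rw [abs_mul]
          exact mul_le_mul_of_nonneg_left (abs_le_simError _ _) (abs_nonneg _)
  have h2 : |(c 0 : ℝ) + ∑ j : Fin n, θ j * (c j.succ : ℝ)| ≤ 0 := by
    have := hE.const_mul (∑ j : Fin n, |(c j.succ : ℝ)|)
    rw [mul_zero] at this
    exact ge_of_tendsto' this h1
  have h3 := eq_zero_of_linearForm_eq_zero hθ c (abs_nonpos_iff.1 h2)
  ext x
  simp [hfc, h3]

/-- The coordinates `x₀, x₀ θ_1 - x_1, ..., x₀ θ_n - x_n`. -/
noncomputable def simMatrix (θ : Fin n → ℝ) : Matrix (Fin (n + 1)) (Fin (n + 1)) ℝ :=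
  Matrix.of (Fin.cons (Fin.cons 1 θ) fun i => Fin.cons 0 (Pi.single i (-1)))

theorem simMatrix_det_ne_zero : (simMatrix θ).det ≠ 0 := by
  rw [Matrix.det_of_isUpperTriangular]
  · refine Finset.prod_ne_zero_iff.2 fun i _ => ?_
    refine Fin.cases ?_ (fun i => ?_) i <;> simp [simMatrix]
  · intro i j hij
    have hij : j < i := hij
    revert hij
    refine Fin.cases (by simp) (fun i => ?_) i
    refine Fin.cases (by simp [simMatrix]) (fun j hij => ?_) j
    have : j ≠ i := (Fin.succ_lt_succ_iff.1 hij).ne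
    simp [simMatrix, this]

theorem vecMul_simMatrix_zero (x : Fin (n + 1) → ℤ) :
    Matrix.vecMul (fun j => (x j : ℝ)) (simMatrix θ) 0 = x 0 := by
  simp [Matrix.vecMul, dotProduct, Fin.sum_univ_succ, simMatrix]

theorem vecMul_simMatrix_succ (x : Fin (n + 1) → ℤ) (i : Fin n) :
    Matrix.vecMul (fun j => (x j : ℝ)) (simMatrix θ) i.succ = x 0 * θ i - x i.succ := by
  simp [Matrix.vecMul, dotProduct, Fin.sum_univ_succ, simMatrix, Pi.single_apply]
  ring

theorem log_le_of_le_rpow_neg {x y γ : ℝ} (hx : 0 < x) (hy : 0 < y) (h : x ≤ y ^ (-γ)) :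
    Real.log x ≤ -γ * Real.log y := by
  rw [← Real.log_rpow hy]
  exact Real.log_le_log hx h

theorem le_log_of_rpow_neg_le {x y γ : ℝ} (hy : 0 < y) (h : y ^ (-γ) ≤ x) :
    -γ * Real.log y ≤ Real.log x := by
  rw [← Real.log_rpow hy]
  exact Real.log_le_log (Real.rpow_pos_of_pos hy _) h

theorem size_rpow_le_error {V : Type*} {N E : V → ℝ} {γ : ℝ} {x : V} (hx : 0 < N x)
    (h : ¬ Solvable N E γ (N x)) : N x ^ (-γ) ≤ E x := by
  by_contra! hlt
  exact h ⟨x, hlt.le, hx, le_rfl⟩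

theorem one_le_size {V : Type*} {N : V → ℝ} (hint : ∀ x, ∃ k : ℕ, N x = k) {x : V}
    (hx : 0 < N x) : 1 ≤ N x := by
  obtain ⟨k, hk⟩ := hint x
  rw [hk] at hx ⊢
  exact_mod_cast hx

/-- The uniform exponent of simultaneous approximation does not exceed `1`. -/
theorem le_one_of_eventually_simSolvable
    (hθ : LinearIndependent ℚ (Fin.cons 1 θ : Fin (n + 1) → ℝ)) (hn : 0 < n) {γ : ℝ}
    (h : ∀ᶠ t in atTop, SimSolvable θ γ t) : γ ≤ 1 := by
  by_contra! hγ
  have hint : ∀ x : Fin (n + 1) → ℤ, ∃ k : ℕ, simSize x = k := fun x => ⟨_, rfl⟩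
  obtain ⟨u, hu0, hmono, hanti, hstep, hN, hE⟩ := exists_best_sequence finite_sim
    (simError_pos hθ hn) hint (by linarith) (eventually_simSolvable_iff.1 h)
  obtain ⟨e, rfl⟩ : ∃ e, n = e + 1 := ⟨n - 1, by omega⟩
  set C := Real.log ((e + 1).factorial * 2 ^ (e + 1) / |(simMatrix θ).det|) with hC
  obtain ⟨s, hs⟩ := ((Real.tendsto_log_atTop.comp hN).eventually_gt_atTop (C / (γ - 1))).exists
  have hu1 : ∀ i, 1 ≤ simSize (u i) := fun i => one_le_size hint (hu0 i)
  obtain ⟨σ, -, -, hσ⟩ := exists_steps_log_le (fun i => u (s + i))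
    (sim_span hθ _ (fun i => hu1 _) (hE.comp (tendsto_add_atTop_nat s |>.congr fun i => by
      rw [add_comm]))) (simMatrix θ) simMatrix_det_ne_zero
    (fun i => simSize (u (s + i))) (fun i => simError θ (u (s + i))) _ (fun i => rfl)
    (fun i => by rw [vecMul_simMatrix_zero, simSize_eq]) (fun i => hu0 _)
    (fun i j hij => hmono (Nat.add_le_add_left hij s))
    (fun i j => by rw [vecMul_simMatrix_succ]; exact abs_le_simError _ _)
    (fun i j hij => hanti (Nat.add_le_add_left hij s))
    (fun i => simError_pos hθ hn _ (hu0 _))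
  have hL : ∀ i, 0 ≤ Real.log (simSize (u (s + i))) := fun i => Real.log_nonneg (hu1 _)
  have hle : ∀ i, Real.log (simSize (u s)) ≤ Real.log (simSize (u (s + i))) := fun i =>
    Real.log_le_log (hu0 _) (hmono (Nat.le_add_right s i))
  have hterm : ∀ i, Real.log (simError θ (u (s + i))) + Real.log (simSize (u (s + (i + 1)))) -
      Real.log (simSize (u (s + i))) ≤ (1 - γ) * Real.log (simSize (u s)) -
        Real.log (simSize (u s)) := by
    intro i
    have h1 := log_le_of_le_rpow_neg (simError_pos hθ hn _ (hu0 _)) (hu0 _) (hstep (s + i))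
    have h2 := mul_le_mul_of_nonneg_left (hle (i + 1)) (by linarith : 0 ≤ γ - 1)
    have h3 := hle i
    rw [show s + (i + 1) = s + i + 1 by ring] at h2 ⊢
    linarith
  rw [Finset.sum_range_succ'] at hσ
  have h4 : ∑ k ∈ Finset.range e, (Real.log (simError θ (u (s + σ (k + 1)))) +
      Real.log (simSize (u (s + (σ (k + 1) + 1)))) -
      Real.log (simSize (u (s + σ (k + 1))))) ≤ 0 := by
    refine Finset.sum_nonpos fun k _ => (hterm _).trans ?_
    have := mul_nonneg (by linarith : 0 ≤ γ - 1) (hL 0)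
    have := hL 0
    simp only [add_zero] at *
    linarith
  have h5 := hterm (σ 0)
  have h6 : C < Real.log (simSize (u s)) * (γ - 1) := (div_lt_iff₀ (by linarith)).1 hs
  simp only [add_zero] at hσ
  linarith

/-- Comparison of the uniform and the ordinary exponent of simultaneous approximation. -/
theorem geo_le_of_simSolvable {e : ℕ} {θ : Fin (e + 1) → ℝ}
    (hθ : LinearIndependent ℚ (Fin.cons 1 θ : Fin (e + 1 + 1) → ℝ)) {γ γ' : ℝ} (hγ : 0 < γ)
    (hγ' : 0 < γ') (h : ∀ᶠ t in atTop, SimSolvable θ γ t)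
    (h' : ∀ᶠ t in atTop, ¬ SimSolvable θ γ' t) :
    geo (γ' / γ) e ≤ (1 - γ) * geo (γ' / γ) (e + 1) := by
  by_contra! hlt
  have hn := Nat.succ_pos e
  have hint : ∀ x : Fin (e + 1 + 1) → ℤ, ∃ k : ℕ, simSize x = k := fun x => ⟨_, rfl⟩
  obtain ⟨u, hu0, hmono, hanti, hstep, hN, hE⟩ := exists_best_sequence finite_sim
    (simError_pos hθ hn) hint hγ (eventually_simSolvable_iff.1 h)
  set C := Real.log ((e + 1).factorial * 2 ^ (e + 1) / |(simMatrix θ).det|) with hC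
  set r := γ' / γ with hr
  have hr0 : 0 < r := div_pos hγ' hγ
  set D := geo r e - (1 - γ) * geo r (e + 1) with hD
  have hD0 : 0 < D := by linarith
  have h1 : ∀ᶠ i in atTop, ¬ Solvable simSize (simError θ) γ' (simSize (u i)) := by
    refine hN.eventually (p := fun t => ¬ Solvable simSize (simError θ) γ' t) ?_
    filter_upwards [h', eventually_gt_atTop 0] with t ht ht0
    rwa [← simSolvable_iff ht0]
  obtain ⟨s₀, hs₀⟩ := eventually_atTop.1 h1
  obtain ⟨s, hs, hss⟩ := (((Real.tendsto_log_atTop.comp hN).eventually_gt_atTop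
    (geo r (e + 1) * C / D)).and (eventually_ge_atTop s₀)).exists
  have hu1 : ∀ i, 1 ≤ simSize (u i) := fun i => one_le_size hint (hu0 i)
  have hlogstep : ∀ i, Real.log (simError θ (u (s + i))) ≤
      -γ * Real.log (simSize (u (s + (i + 1)))) := fun i =>
    log_le_of_le_rpow_neg (simError_pos hθ hn _ (hu0 _)) (hu0 _) (hstep (s + i))
  obtain ⟨σ, -, hσ⟩ := exists_steps_geo (fun i => u (s + i))
    (sim_span hθ _ (fun i => hu1 _) (hE.comp (tendsto_add_atTop_nat s |>.congr fun i => by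
      rw [add_comm]))) (simMatrix θ) simMatrix_det_ne_zero
    (fun i => simSize (u (s + i))) (fun i => simError θ (u (s + i))) _ (fun i => rfl)
    (fun i => by rw [vecMul_simMatrix_zero, simSize_eq]) (fun i => hu0 _)
    (fun i j hij => hmono (Nat.add_le_add_left hij s))
    (fun i j => by rw [vecMul_simMatrix_succ]; exact abs_le_simError _ _)
    (fun i j hij => hanti (Nat.add_le_add_left hij s))
    (fun i => simError_pos hθ hn _ (hu0 _)) (κ := γ) hr0
    (fun i _ => hlogstep i)
    (fun i _ => by
      have h2 := le_log_of_rpow_neg_le (hu0 _) (size_rpow_le_error (hu0 _)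
        (hs₀ (s + i) (hss.trans (Nat.le_add_right s i))))
      have h3 := hlogstep i
      rw [hr, div_mul_eq_mul_div, le_div_iff₀ hγ]
      linarith)
  have hle : ∀ i, Real.log (simSize (u s)) ≤ Real.log (simSize (u (s + i))) := fun i =>
    Real.log_le_log (hu0 _) (hmono (Nat.le_add_right s i))
  have h4 : Real.log (simSize (u s)) ≤
      ∑ k ∈ Finset.range (e + 1), Real.log (simSize (u (s + (σ k + 1)))) :=
    (hle _).trans (Finset.single_le_sum
      (f := fun k => Real.log (simSize (u (s + (σ k + 1)))))
      (fun k _ => Real.log_nonneg (hu1 _)) (Finset.mem_range.2 (Nat.succ_pos e)))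
  have h5 : geo r (e + 1) * C < Real.log (simSize (u s)) * D := (div_lt_iff₀ hD0).1 hs
  have h6 := mul_le_mul_of_nonneg_left h4 hD0.le
  have h7 := mul_le_mul_of_nonneg_left (hle (σ 0)) (geo_nonneg hr0.le (e + 1))
  simp only [add_zero] at hσ
  rw [hD] at h5 h6
  linarith

theorem abs_linearMap_le {M : ℝ} (g : (Fin n → ℤ) →ₗ[ℤ] ℤ) (x : Fin n → ℤ)
    (hx : ∀ i, |(x i : ℝ)| ≤ M) :
    |(g x : ℝ)| ≤ (∑ i, |(g (Pi.single i 1) : ℝ)|) * M := by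
  have h1 : g x = ∑ i, x i * g (Pi.single i 1) := by
    rw [LinearMap.pi_apply_eq_sum_univ g x]
    refine Finset.sum_congr rfl fun j _ => ?_
    rw [smul_eq_mul]
    congr 2
    ext k
    simp [Pi.single_apply, eq_comm]
  rw [h1, Int.cast_sum, Finset.sum_mul]
  refine (Finset.abs_sum_le_sum_abs _ _).trans (Finset.sum_le_sum fun i _ => ?_)
  rw [Int.cast_mul, abs_mul, mul_comm]
  exact mul_le_mul_of_nonneg_left (hx i) (abs_nonneg _)

/-- A subgroup of `ℤ ^ n` has a basis whose coordinates are bounded by the size of the point. -/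
theorem exists_basis_coord_le (Λ : Submodule ℤ (Fin n → ℤ)) :
    ∃ d ≤ n, ∃ b : Module.Basis (Fin d) ℤ Λ, ∃ C > 0, ∀ (x : Λ) (M : ℝ),
      (∀ i, |((x : Fin n → ℤ) i : ℝ)| ≤ M) → ∀ j, |(b.repr x j : ℝ)| ≤ C * M := by
  obtain ⟨d, S⟩ := Submodule.smithNormalForm (Pi.basisFun ℤ (Fin n)) Λ
  have hd : d ≤ n := by simpa using Fintype.card_le_of_embedding S.f
  set K : Fin d → ℝ := fun j => ∑ i, |(S.bM.coord (S.f j) (Pi.single i 1) : ℝ)| with hK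
  have hK0 : ∀ j, 0 ≤ K j := fun j => Finset.sum_nonneg fun _ _ => abs_nonneg _
  refine ⟨d, hd, S.bN, 1 + ∑ j, K j, by
    linarith [Finset.sum_nonneg fun j (_ : j ∈ Finset.univ) => hK0 j], fun x M hx j => ?_⟩
  have hM : 0 ≤ M := (abs_nonneg _).trans (hx (S.f j))
  have ha : S.a j ≠ 0 := by
    intro h
    have h1 := S.snf j
    rw [h, zero_smul] at h1
    exact S.bN.ne_zero j (Subtype.ext h1)
  have h1 : S.bM.coord (S.f j) (x : Fin n → ℤ) = S.bN.repr x j * S.a j := by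
    conv_lhs => rw [← S.bN.sum_repr x]
    simp only [Submodule.coe_sum, Submodule.coe_smul, map_sum, map_smul, S.snf,
      Module.Basis.coord_apply, Module.Basis.repr_self, smul_eq_mul]
    rw [Finset.sum_eq_single j]
    · simp
    · intro i _ hi
      have : S.f i ≠ S.f j := fun h => hi (S.f.injective h)
      simp [this]
    · simp
  have h2 : |(S.bN.repr x j : ℝ)| ≤ |(S.bM.coord (S.f j) (x : Fin n → ℤ) : ℝ)| := by
    rw [h1, Int.cast_mul, abs_mul]
    refine le_mul_of_one_le_right (abs_nonneg _) ?_
    exact_mod_cast Int.one_le_abs ha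
  refine h2.trans ((abs_linearMap_le _ _ hx).trans (mul_le_mul_of_nonneg_right ?_ hM))
  have := Finset.single_le_sum (fun j _ => hK0 j) (Finset.mem_univ j)
  change K j ≤ _
  linarith

/-- The first members of a sequence of integer points span the same lattice as all of them. -/
theorem exists_span_stable (u : ℕ → Fin n → ℤ) :
    ∃ R₀, ∀ i, u i ∈ Submodule.span ℤ (u '' Set.Iic R₀) := by
  obtain ⟨R₀, h⟩ := monotone_stabilizes_iff_noetherian.2
    (inferInstance : IsNoetherian ℤ (Fin n → ℤ))
    ⟨fun R => Submodule.span ℤ (u '' Set.Iic R), fun i j hij =>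
      Submodule.span_mono (Set.image_mono (Set.Iic_subset_Iic.2 hij))⟩
  refine ⟨R₀, fun i => ?_⟩
  have h1 : u i ∈ Submodule.span ℤ (u '' Set.Iic (max i R₀)) :=
    Submodule.subset_span ⟨i, Set.mem_Iic.2 (le_max_left _ _), rfl⟩
  have h2 : Submodule.span ℤ (u '' Set.Iic R₀) = Submodule.span ℤ (u '' Set.Iic (max i R₀)) :=
    h (max i R₀) (le_max_right _ _)
  rwa [h2]

/-- If the points `x` with `x ∈ s` span a lattice, a rational functional of the coordinates which
vanishes on `s` is zero. -/
theorem eq_zero_of_repr_eq_zero {d : ℕ} {s : Set (Fin n → ℤ)}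
    (b : Module.Basis (Fin d) ℤ (Submodule.span ℤ s)) (f : (Fin d → ℚ) →ₗ[ℚ] ℚ)
    (hf : ∀ (x : Submodule.span ℤ s), (x : Fin n → ℤ) ∈ s → f (fun j => (b.repr x j : ℚ)) = 0) :
    f = 0 := by
  have h1 : ∀ x (hx : x ∈ Submodule.span ℤ s), f (fun j => (b.repr ⟨x, hx⟩ j : ℚ)) = 0 := by
    intro x hx
    induction hx using Submodule.span_induction with
    | mem x h => exact hf ⟨x, _⟩ h
    | zero =>
      rw [show (⟨0, Submodule.zero_mem _⟩ : Submodule.span ℤ s) = 0 from rfl]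
      simp only [map_zero, Finsupp.coe_zero, Pi.zero_apply, Int.cast_zero]
      exact map_zero f
    | add x y hx hy h1 h2 =>
      rw [show (⟨x + y, Submodule.add_mem _ hx hy⟩ : Submodule.span ℤ s) =
        ⟨x, hx⟩ + ⟨y, hy⟩ from rfl]
      simp only [map_add, Finsupp.coe_add, Pi.add_apply, Int.cast_add]
      have := map_add f (fun j => (b.repr ⟨x, hx⟩ j : ℚ)) (fun j => (b.repr ⟨y, hy⟩ j : ℚ))
      rw [h1, h2, add_zero] at this
      exact this
    | smul a x hx h1 =>
      rw [show (⟨a • x, Submodule.smul_mem _ a hx⟩ : Submodule.span ℤ s) =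
        a • ⟨x, hx⟩ from rfl]
      simp only [map_smul, Finsupp.coe_smul, Pi.smul_apply, smul_eq_mul, Int.cast_mul]
      have := map_smul f (a : ℚ) (fun j => (b.repr ⟨x, hx⟩ j : ℚ))
      rw [h1, smul_zero] at this
      exact this
  refine LinearMap.pi_ext' fun i => LinearMap.ext_ring ?_
  have h2 := h1 (b i) (b i).2
  rw [Subtype.coe_eta, b.repr_self] at h2
  simp only [LinearMap.comp_apply, LinearMap.coe_single, LinearMap.zero_apply]
  rw [← h2]
  congr 1
  ext j
  by_cases h : j = i <;> simp [h]

/-- The coordinates consisting of a linear form with coefficients `ξ` and of all but the first of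
the standard coordinates, divided by `C`. -/
noncomputable def linMatrix {d : ℕ} (ξ : Fin (d + 1) → ℝ) (C : ℝ) :
    Matrix (Fin (d + 1)) (Fin (d + 1)) ℝ :=
  Matrix.of (Fin.cons (Fin.cons (ξ 0) 0) fun i => Fin.cons (ξ i.succ) (Pi.single i C⁻¹))

theorem linMatrix_det_ne_zero {d : ℕ} {ξ : Fin (d + 1) → ℝ} {C : ℝ} (hξ : ξ 0 ≠ 0) (hC : C ≠ 0) :
    (linMatrix ξ C).det ≠ 0 := by
  rw [Matrix.det_of_isLowerTriangular]
  · refine Finset.prod_ne_zero_iff.2 fun i _ => ?_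
    refine Fin.cases ?_ (fun i => ?_) i <;> simp [linMatrix, hξ, hC]
  · intro i j hij
    have hij : i < j := hij
    revert hij
    refine Fin.cases (by simp) (fun j => ?_) j
    refine Fin.cases (by simp [linMatrix]) (fun i hij => ?_) i
    have : j ≠ i := (Fin.succ_lt_succ_iff.1 hij).ne'
    simp [linMatrix, this]

theorem vecMul_linMatrix_zero {d : ℕ} {ξ : Fin (d + 1) → ℝ} {C : ℝ} (x : Fin (d + 1) → ℤ) :
    Matrix.vecMul (fun j => (x j : ℝ)) (linMatrix ξ C) 0 = ∑ j, (x j : ℝ) * ξ j := by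
  simp [Matrix.vecMul, dotProduct, Fin.sum_univ_succ, linMatrix]

theorem vecMul_linMatrix_succ {d : ℕ} {ξ : Fin (d + 1) → ℝ} {C : ℝ} (x : Fin (d + 1) → ℤ)
    (i : Fin d) :
    Matrix.vecMul (fun j => (x j : ℝ)) (linMatrix ξ C) i.succ = x i.succ * C⁻¹ := by
  simp [Matrix.vecMul, dotProduct, Fin.sum_univ_succ, linMatrix, Pi.single_apply]

theorem geo_inv {r : ℝ} (hr : 0 < r) (e : ℕ) : r ^ e * geo r⁻¹ (e + 1) = geo r (e + 1) := by
  rw [geo, geo, Finset.mul_sum, ← Finset.sum_range_reflect]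
  refine Finset.sum_congr rfl fun i hi => ?_
  have : i < e + 1 := Finset.mem_range.1 hi
  rw [inv_pow, show e + 1 - 1 - i = e - i by omega, pow_sub₀ _ hr.ne' (by omega : i ≤ e)]
  field_simp

theorem geo_mono_right {r : ℝ} (hr : 0 ≤ r) {a b : ℕ} (h : a ≤ b) : geo r a ≤ geo r b :=
  Finset.sum_le_sum_of_subset_of_nonneg (Finset.range_mono h) fun _ _ _ => pow_nonneg hr _

/-- Comparison of the uniform and the ordinary exponent of a linear form. -/
theorem le_geo_of_linSolvable (hθ : LinearIndependent ℚ (Fin.cons 1 θ : Fin (n + 1) → ℝ))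
    {γ γ' : ℝ} (hγ : 0 < γ) (hγ' : 0 < γ') (h : ∀ᶠ t in atTop, LinSolvable θ γ t)
    (h' : ∀ᶠ t in atTop, ¬ LinSolvable θ γ' t) : γ ≤ geo (γ' / γ) n := by
  by_contra! hlt
  have hint : ∀ x : Fin (n + 1) → ℤ, ∃ k : ℕ, linSize x = k := fun x => ⟨_, rfl⟩
  obtain ⟨w, hw0, hmono, hanti, hstep, hN, hE⟩ := exists_best_sequence finite_lin
    (linForm_pos hθ) hint hγ (eventually_linSolvable_iff.1 h)
  have h1 : ∀ᶠ i in atTop,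
      ¬ Solvable linSize (fun x => |linForm θ x|) γ' (linSize (w i)) := by
    refine hN.eventually (p := fun t => ¬ Solvable linSize (fun x => |linForm θ x|) γ' t) ?_
    filter_upwards [h', eventually_gt_atTop 0] with t ht ht0
    rwa [← linSolvable_iff ht0]
  obtain ⟨s, hs⟩ := eventually_atTop.1
    (h1.and (hE.eventually (ge_mem_nhds one_pos)))
  set u : ℕ → Fin (n + 1) → ℤ := fun i => w (s + i) with hu
  have hu0 : ∀ i, 0 < linSize (u i) := fun i => hw0 _
  have hu1 : ∀ i, 1 ≤ linSize (u i) := fun i => one_le_size hint (hu0 i)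
  have humono : ∀ {i j}, i ≤ j → linSize (u i) ≤ linSize (u j) := fun hij =>
    hmono (Nat.add_le_add_left hij s)
  have huanti : ∀ {i j}, i ≤ j → |linForm θ (u j)| ≤ |linForm θ (u i)| := fun hij =>
    hanti (Nat.add_le_add_left hij s)
  have hupos : ∀ i, 0 < |linForm θ (u i)| := fun i => linForm_pos hθ _ (hu0 i)
  have huE1 : ∀ i, |linForm θ (u i)| ≤ 1 := fun i => (hs (s + i) (Nat.le_add_right s i)).2
  have hulog : ∀ i, Real.log |linForm θ (u i)| ≤ -γ * Real.log (linSize (u (i + 1))) := fun i =>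
    log_le_of_le_rpow_neg (hupos i) (hu0 _) (hstep (s + i))
  have hulog' : ∀ i, -γ' * Real.log (linSize (u i)) ≤ Real.log |linForm θ (u i)| := fun i =>
    le_log_of_rpow_neg_le (hu0 _)
      (size_rpow_le_error (hu0 _) (hs (s + i) (Nat.le_add_right s i)).1)
  have huE : Tendsto (fun i => |linForm θ (u i)|) atTop (𝓝 0) :=
    hE.comp (tendsto_add_atTop_nat s |>.congr fun i => by rw [add_comm])
  obtain ⟨R₀, hR₀⟩ := exists_span_stable u
  obtain ⟨d', hd', b, C₀, hC₀, hb⟩ := exists_basis_coord_le (Submodule.span ℤ (u '' Set.Iic R₀))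
  set m : ℕ → Fin d' → ℤ := fun i j => b.repr ⟨u i, hR₀ i⟩ j with hm
  have hmspan : ∀ R, R₀ ≤ R → ∀ f : (Fin d' → ℚ) →ₗ[ℚ] ℚ,
      (∀ i, f (fun j => (m (R - i) j : ℚ)) = 0) → f = 0 := by
    intro R hR f hf
    refine eq_zero_of_repr_eq_zero b f fun x hx => ?_
    obtain ⟨i, hi, hix⟩ := hx
    have hiR : i ≤ R := le_trans hi hR
    have := hf (R - i)
    rw [Nat.sub_sub_self hiR] at this
    convert this using 6
    exact Subtype.ext hix.symm
  set ξ : Fin d' → ℝ := fun j => linForm θ (b j) with hξ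
  have hform : ∀ i, linForm θ (u i) = ∑ j, (m i j : ℝ) * ξ j := by
    intro i
    have h2 : u i = ∑ j, m i j • (b j : Fin (n + 1) → ℤ) := by
      have := congrArg Subtype.val (b.sum_repr ⟨u i, hR₀ i⟩)
      simp only [Submodule.coe_sum, Submodule.coe_smul] at this
      exact this.symm
    conv_lhs => rw [h2]
    rw [map_sum]
    refine Finset.sum_congr rfl fun j _ => ?_
    rw [map_smul, zsmul_eq_mul]
  have hξ0 : ∀ j, ξ j ≠ 0 := fun j =>
    linForm_ne_zero hθ fun h => b.ne_zero j (Subtype.ext h)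
  set C := C₀ * (1 + (1 + ∑ i, |θ i|)) with hC
  have hCpos : 0 < C := by
    have : 0 ≤ ∑ i, |θ i| := Finset.sum_nonneg fun _ _ => abs_nonneg _
    positivity
  have hcoord : ∀ i j, |(m i j : ℝ)| ≤ C * linSize (u i) := by
    intro i j
    have h2 := hb ⟨u i, hR₀ i⟩ ((1 + (1 + ∑ i, |θ i|)) * linSize (u i)) (fun k => by
      refine (abs_le_of_lin (θ := θ) (u i) k).trans ?_
      have := (huE1 i).trans (hu1 i)
      linarith) j
    rw [hC, mul_assoc]
    exact h2
  obtain ⟨d, rfl⟩ : ∃ d, d' = d + 1 := by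
    refine Nat.exists_eq_succ_of_ne_zero fun h0 => ?_
    subst h0
    have h2 := hform 0
    rw [Fin.sum_univ_zero] at h2
    have := hupos 0
    rw [h2] at this
    simp at this
  have hT := linMatrix_det_ne_zero (C := C) (hξ0 0) hCpos.ne'
  have hmne : ∀ R i, m (R - (i + 1)) ≠ m (R - i) → R - i = R - (i + 1) + 1 := by
    intro R i hne
    by_contra hR
    exact hne (by rw [show R - (i + 1) = R - i by omega])
  have hentry : ∀ i (j : Fin d),
      |Matrix.vecMul (fun j => (m i j : ℝ)) (linMatrix ξ C) j.succ| ≤ linSize (u i) := by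
    intro i j
    rw [vecMul_linMatrix_succ, abs_mul, abs_inv, abs_of_pos hCpos, ← div_eq_mul_inv,
      div_le_iff₀ hCpos, mul_comm]
    exact hcoord i _
  rcases Nat.eq_zero_or_pos d with rfl | hdpos
  · obtain ⟨R, hR, hRR⟩ := ((huE.eventually (gt_mem_nhds (abs_pos.2 hT))).and
      (eventually_ge_atTop R₀)).exists
    obtain ⟨σ, -, -, hσ⟩ := exists_steps_le_prod (fun i => m (R - i)) (hmspan R hRR)
      (linMatrix ξ C) (fun i => |linForm θ (u (R - i))|) (fun i => linSize (u (R - i))) _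
      (fun i => rfl) (fun i => by rw [vecMul_linMatrix_zero, hform]) (fun i => hupos _)
      (fun i j hij => huanti (Nat.sub_le_sub_left hij R)) (fun i j => hentry _ j)
      (fun i j hij => humono (Nat.sub_le_sub_left hij R)) (fun i => hu0 _)
    rw [Finset.range_zero, Finset.prod_empty, Nat.factorial_zero, Nat.cast_one, mul_one,
      mul_one] at hσ
    exact absurd hσ (not_le.2 hR)
  · obtain ⟨e, rfl⟩ : ∃ e, d = e + 1 := ⟨d - 1, by omega⟩
    set r := γ / γ' with hr
    have hr0 : 0 < r := div_pos hγ hγ'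
    set D := (1 - γ⁻¹) * geo r (e + 1) - geo r e with hD
    have hD0 : 0 < D := by
      have h2 : geo r⁻¹ (e + 1) < γ := by
        rw [hr, inv_div]
        exact (geo_mono_right (div_pos hγ' hγ).le (by omega)).trans_lt hlt
      have h3 : γ⁻¹ * geo r (e + 1) < r ^ e := by
        rw [← geo_inv hr0, inv_mul_lt_iff₀ hγ, mul_comm γ]
        exact mul_lt_mul_of_pos_left h2 (pow_pos hr0 e)
      rw [hD, geo_succ r e] at *
      linarith
    set G := geo r (e + 1) with hG
    have hG0 : 0 < G := geo_succ_pos hr0.le e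
    set K := Real.log ((e + 1).factorial * 2 ^ (e + 1) / |(linMatrix ξ C).det|) with hK
    set ε := min G (D * r) with hε
    have hε0 : 0 < ε := lt_min hG0 (mul_pos hD0 hr0)
    have hlog : Tendsto (fun i => Real.log |linForm θ (u i)|) atTop atBot :=
      Real.tendsto_log_nhdsGT_zero.comp (tendsto_nhdsWithin_iff.2
        ⟨huE, Eventually.of_forall hupos⟩)
    obtain ⟨R, hR, hRR⟩ := ((hlog.eventually_lt_atBot (-(G * K) / ε)).and
      (eventually_ge_atTop R₀)).exists
    obtain ⟨σ, hσ0, hσ⟩ := exists_steps_geo (fun i => m (R - i)) (hmspan R hRR)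
      (linMatrix ξ C) hT (fun i => |linForm θ (u (R - i))|) (fun i => linSize (u (R - i))) _
      (fun i => rfl) (fun i => by rw [vecMul_linMatrix_zero, hform]) (fun i => hupos _)
      (fun i j hij => huanti (Nat.sub_le_sub_left hij R)) (fun i j => hentry _ j)
      (fun i j hij => humono (Nat.sub_le_sub_left hij R)) (fun i => hu0 _) (κ := γ⁻¹) hr0
      (fun i hi => by
        have h2 := hulog (R - (i + 1))
        rw [← hmne R i hi] at h2
        have h3 := mul_le_mul_of_nonneg_left h2 (inv_pos.2 hγ).le
        rw [neg_mul, mul_neg, inv_mul_cancel_left₀ hγ.ne'] at h3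
        linarith)
      (fun i hi => by
        have h2 := hulog (R - (i + 1))
        rw [← hmne R i hi] at h2
        have h3 := mul_le_mul_of_nonneg_left (hulog' (R - i)) hr0.le
        have h4 : r * (-γ' * Real.log (linSize (u (R - i)))) =
            -γ * Real.log (linSize (u (R - i))) := by
          rw [hr]
          field_simp
        linarith)
    have hnonpos : ∀ i, Real.log |linForm θ (u i)| ≤ 0 := fun i =>
      Real.log_nonpos (abs_nonneg _) (huE1 i)
    have h2 : ∑ k ∈ Finset.range (e + 1), Real.log |linForm θ (u (R - (σ k + 1)))| ≤
        r * Real.log |linForm θ (u (R - σ 0))| := by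
      rw [Finset.sum_range_succ']
      have h3 : ∑ k ∈ Finset.range e, Real.log |linForm θ (u (R - (σ (k + 1) + 1)))| ≤ 0 :=
        Finset.sum_nonpos fun k _ => hnonpos _
      have h4 := hulog (R - (σ 0 + 1))
      rw [← hmne R _ hσ0] at h4
      have h5 := mul_le_mul_of_nonneg_left (hulog' (R - σ 0)) hr0.le
      have h6 : r * (-γ' * Real.log (linSize (u (R - σ 0)))) =
          -γ * Real.log (linSize (u (R - σ 0))) := by
        rw [hr]
        field_simp
      linarith
    have h3 := mul_le_mul_of_nonneg_left h2 hD0.le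
    have h4 : Real.log |linForm θ (u R)| ≤ Real.log |linForm θ (u (R - σ 0))| :=
      Real.log_le_log (hupos _) (huanti (Nat.sub_le R _))
    have h5 := mul_le_mul_of_nonpos_right (min_le_left G (D * r)) (sub_nonpos.2 h4)
    have h6 := mul_le_mul_of_nonpos_right (min_le_right G (D * r)) (hnonpos (R - σ 0))
    have h7 : Real.log |linForm θ (u R)| * ε < -(G * K) := (lt_div_iff₀ hε0).1 hR
    simp only [Nat.sub_zero] at hσ
    rw [← hε] at h5 h6
    nlinarith

/-- Pigeonhole principle for fractional parts: the map sending `a` to the `1 / Q`-box containing it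
determines `a` up to `1 / Q`. -/
theorem abs_sub_le_of_floor_eq {Q : ℕ} (hQ : 0 < Q) {a b : ℝ} (h : ⌊(Q : ℝ) * a⌋ = ⌊(Q : ℝ) * b⌋) :
    |a - b| ≤ 1 / Q := by
  have hQ' : (0 : ℝ) < Q := by exact_mod_cast hQ
  have h1 := Int.abs_sub_lt_one_of_floor_eq_floor h
  rw [← mul_sub, abs_mul, abs_of_pos hQ'] at h1
  rw [le_div_iff₀ hQ', mul_comm]
  exact h1.le

theorem floor_mul_fract_lt {Q : ℕ} (hQ : 0 < Q) (a : ℝ) : ⌊(Q : ℝ) * Int.fract a⌋.toNat < Q := by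
  have hQ' : (0 : ℝ) < Q := by exact_mod_cast hQ
  rw [Int.toNat_lt (Int.floor_nonneg.2 (mul_nonneg hQ'.le (Int.fract_nonneg a))), Int.floor_lt]
  push_cast
  exact mul_lt_of_lt_one_right hQ' (Int.fract_lt_one a)

/-- The index of the box of length `1 / Q` containing the fractional part of `a`. -/
noncomputable def fractBox {Q : ℕ} (hQ : 0 < Q) (a : ℝ) : Fin Q :=
  ⟨⌊(Q : ℝ) * Int.fract a⌋.toNat, floor_mul_fract_lt hQ a⟩

theorem abs_fract_sub_fract_le {Q : ℕ} (hQ : 0 < Q) {a b : ℝ} (h : fractBox hQ a = fractBox hQ b) :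
    |Int.fract a - Int.fract b| ≤ 1 / Q := by
  refine abs_sub_le_of_floor_eq hQ ?_
  have h1 := congrArg Fin.val h
  have h2 : ∀ a, 0 ≤ ⌊(Q : ℝ) * Int.fract a⌋ := fun a =>
    Int.floor_nonneg.2 (mul_nonneg (Nat.cast_nonneg _) (Int.fract_nonneg a))
  simp only [fractBox] at h1
  rw [← Int.toNat_of_nonneg (h2 a), ← Int.toNat_of_nonneg (h2 b), h1]

theorem dirichlet_sim (θ : Fin n → ℝ) {Q : ℕ} (hQ : 0 < Q) :
    ∃ x : Fin (n + 1) → ℤ, (∀ i : Fin n, |(x 0 : ℝ) * θ i - (x i.succ : ℝ)| ≤ 1 / Q) ∧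
      0 < |(x 0 : ℝ)| ∧ |(x 0 : ℝ)| ≤ (Q : ℝ) ^ n := by
  obtain ⟨k, l, hkl, h⟩ := Fintype.exists_ne_map_eq_of_card_lt
    (fun (k : Fin (Q ^ n + 1)) (i : Fin n) => fractBox hQ (k * θ i)) (by simp)
  refine ⟨Fin.cons ((k : ℕ) - (l : ℕ) : ℤ) fun i => ⌊(k : ℕ) * θ i⌋ - ⌊(l : ℕ) * θ i⌋, ?_, ?_, ?_⟩
  · intro i
    have := abs_fract_sub_fract_le hQ (congrFun h i)
    rw [Int.fract, Int.fract] at this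
    convert this using 2
    simp only [Fin.cons_zero, Fin.cons_succ]
    push_cast
    ring
  · simp only [Fin.cons_zero, abs_pos]
    have : (k : ℕ) ≠ l := fun h => hkl (Fin.ext h)
    push_cast
    rw [sub_ne_zero]
    exact_mod_cast this
  · simp only [Fin.cons_zero]
    have h1 : ((k : ℕ) : ℝ) ≤ (Q : ℝ) ^ n := by exact_mod_cast Nat.lt_succ_iff.1 k.2
    have h2 : ((l : ℕ) : ℝ) ≤ (Q : ℝ) ^ n := by exact_mod_cast Nat.lt_succ_iff.1 l.2
    have h3 : (0 : ℝ) ≤ (k : ℕ) := Nat.cast_nonneg _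
    have h4 : (0 : ℝ) ≤ (l : ℕ) := Nat.cast_nonneg _
    push_cast
    rw [abs_le]
    constructor <;> linarith

theorem dirichlet_lin (hn : n ≠ 0) (θ : Fin n → ℝ) {Q : ℕ} (hQ : 0 < Q) :
    ∃ x : Fin (n + 1) → ℤ, |(x 0 : ℝ) + ∑ i : Fin n, θ i * (x i.succ : ℝ)| ≤ 1 / (Q : ℝ) ^ n ∧
      (∃ i : Fin n, 0 < |(x i.succ : ℝ)|) ∧ ∀ i : Fin n, |(x i.succ : ℝ)| ≤ Q := by
  have hQn : 0 < Q ^ n := pow_pos hQ n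
  obtain ⟨k, l, hkl, h⟩ := Fintype.exists_ne_map_eq_of_card_lt
    (fun k : Fin n → Fin (Q + 1) => fractBox hQn (∑ i, θ i * (k i : ℕ)))
    (by simpa using Nat.pow_lt_pow_left (Nat.lt_succ_self Q) hn)
  refine ⟨Fin.cons (⌊∑ i, θ i * (l i : ℕ)⌋ - ⌊∑ i, θ i * (k i : ℕ)⌋)
    fun i => ((k i : ℕ) - (l i : ℕ) : ℤ), ?_, ?_, ?_⟩
  · have := abs_fract_sub_fract_le hQn h
    rw [Int.fract, Int.fract, Nat.cast_pow] at this
    convert this using 2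
    simp only [Fin.cons_zero, Fin.cons_succ]
    push_cast
    simp only [mul_sub, Finset.sum_sub_distrib]
    ring
  · obtain ⟨i, hi⟩ := Function.ne_iff.1 hkl
    refine ⟨i, ?_⟩
    simp only [Fin.cons_succ, abs_pos]
    have : (k i : ℕ) ≠ l i := fun h => hi (Fin.ext h)
    push_cast
    rw [sub_ne_zero]
    exact_mod_cast this
  · intro i
    simp only [Fin.cons_succ]
    have h1 : ((k i : ℕ) : ℝ) ≤ Q := by exact_mod_cast Nat.lt_succ_iff.1 (k i).2
    have h2 : ((l i : ℕ) : ℝ) ≤ Q := by exact_mod_cast Nat.lt_succ_iff.1 (l i).2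
    have h3 : (0 : ℝ) ≤ (k i : ℕ) := Nat.cast_nonneg _
    have h4 : (0 : ℝ) ≤ (l i : ℕ) := Nat.cast_nonneg _
    push_cast
    rw [abs_le]
    constructor <;> linarith

theorem eventually_const_mul_rpow_lt {e : ℝ} (he : e < 0) (c : ℝ) {ε : ℝ} (hε : 0 < ε) :
    ∀ᶠ t : ℝ in atTop, c * t ^ e < ε := by
  have h1 := (tendsto_rpow_neg_atTop (neg_pos.2 he)).const_mul c
  rw [neg_neg, mul_zero] at h1
  exact h1.eventually (gt_mem_nhds hε)

theorem eventually_simSolvable_of_lt (θ : Fin n → ℝ) {γ : ℝ} (hγ : 0 ≤ γ) (h : γ * n < 1) :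
    ∀ᶠ t in atTop, SimSolvable θ γ t := by
  filter_upwards [eventually_const_mul_rpow_lt (sub_neg.2 h) (2 ^ n) one_pos,
    eventually_ge_atTop 1] with t ht ht1
  have ht0 : 0 < t := by linarith
  have h1 : 1 ≤ t ^ γ := Real.one_le_rpow ht1 hγ
  obtain ⟨x, hx1, hx2, hx3⟩ := dirichlet_sim θ (Nat.ceil_pos.2 (by linarith : 0 < t ^ γ))
  refine ⟨x, fun i => (hx1 i).trans ?_, hx2, hx3.trans ?_⟩
  · rw [Real.rpow_neg ht0.le, ← one_div]
    exact one_div_le_one_div_of_le (by linarith) (Nat.le_ceil _)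
  · have h2 : (⌈t ^ γ⌉₊ : ℝ) ≤ 2 * t ^ γ := by
      have := (Nat.ceil_lt_add_one (by linarith : 0 ≤ t ^ γ)).le
      linarith
    refine (pow_le_pow_left₀ (Nat.cast_nonneg _) h2 n).trans ?_
    rw [mul_pow, ← Real.rpow_mul_natCast ht0.le]
    rw [Real.rpow_sub ht0, Real.rpow_one, ← mul_div_assoc, div_lt_iff₀ ht0, one_mul] at ht
    exact ht.le

theorem eventually_linSolvable_of_lt (hn : n ≠ 0) (θ : Fin n → ℝ) {γ : ℝ} (h : γ < n) :
    ∀ᶠ t in atTop, LinSolvable θ γ t := by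
  filter_upwards [eventually_const_mul_rpow_lt (sub_neg.2 h) (2 ^ n) one_pos,
    eventually_ge_atTop 1] with t ht ht1
  have ht0 : 0 < t := by linarith
  obtain ⟨x, hx1, hx2, hx3⟩ := dirichlet_lin hn θ (Nat.floor_pos.2 ht1)
  refine ⟨x, hx1.trans ?_, hx2, fun i => (hx3 i).trans (Nat.floor_le ht0.le)⟩
  have h1 : t / 2 ≤ (⌊t⌋₊ : ℝ) := by
    have h2 := Nat.lt_floor_add_one t
    have h3 : (1 : ℝ) ≤ ⌊t⌋₊ := by exact_mod_cast Nat.floor_pos.2 ht1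
    linarith
  have h4 : 1 / (⌊t⌋₊ : ℝ) ^ n ≤ 1 / (t / 2) ^ n :=
    one_div_le_one_div_of_le (by positivity) (pow_le_pow_left₀ (by positivity) h1 n)
  refine h4.trans ?_
  rw [Real.rpow_neg ht0.le, ← one_div, div_pow, one_div_div,
    div_le_div_iff₀ (by positivity) (by positivity)]
  rw [Real.rpow_sub ht0, Real.rpow_natCast, ← mul_div_assoc, div_lt_iff₀ (by positivity)] at ht
  linarith

/-- If `x` and `z` are good approximations in the two senses, then they are orthogonal, which
bounds one quality in terms of the other. -/
theorem simSize_mul_le (z x : Fin (n + 1) → ℤ) (h1 : simSize z * |linForm θ x| ≤ 1 / 2)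
    (h2 : n * (linSize x * simError θ z) < 1 / 2) :
    simSize z * |linForm θ x| ≤ n * (linSize x * simError θ z) := by
  set I : ℤ := ∑ i, z i * x i with hI
  set S : ℝ := ∑ i : Fin n, (x i.succ : ℝ) * ((z 0 : ℝ) * θ i - z i.succ) with hS
  have hS' : |S| ≤ n * (linSize x * simError θ z) := by
    refine (Finset.abs_sum_le_sum_abs _ _).trans ?_
    have : ∀ i ∈ (Finset.univ : Finset (Fin n)),
        |(x i.succ : ℝ) * ((z 0 : ℝ) * θ i - z i.succ)| ≤ linSize x * simError θ z := by
      intro i _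
      rw [abs_mul]
      exact mul_le_mul (le_linSize x i) (abs_le_simError z i) (abs_nonneg _) (Nat.cast_nonneg _)
    simpa using Finset.sum_le_sum this
  have h3 : (z 0 : ℝ) * linForm θ x = I + S := by
    rw [linForm_apply, hI, hS, Fin.sum_univ_succ]
    push_cast
    rw [mul_add, Finset.mul_sum, add_assoc, ← Finset.sum_add_distrib]
    congr 1
    exact Finset.sum_congr rfl fun i _ => by ring
  rw [simSize_eq, ← abs_mul] at h1 ⊢
  have h4 : |(I : ℝ)| < 1 := by
    have h5 : (I : ℝ) = (z 0 : ℝ) * linForm θ x - S := by linarith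
    rw [h5]
    have := abs_sub ((z 0 : ℝ) * linForm θ x) S
    linarith
  have h6 : I = 0 := Int.abs_lt_one_iff.1 (by exact_mod_cast h4)
  rw [h3, h6, Int.cast_zero, zero_add]
  exact hS'

theorem frequently_linSolvable_transfer
    (hθ : LinearIndependent ℚ (Fin.cons 1 θ : Fin (n + 1) → ℝ)) (hn : 0 < n) {γ δ η : ℝ}
    (hγ : 0 < γ) (hδ : 0 < δ) (hγδ : 1 < γ * δ) (h : ∀ᶠ t in atTop, LinSolvable θ γ t)
    (h' : ∃ᶠ t in atTop, SimSolvable θ δ t) (hη : η < γ * (1 + δ) - 1) :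
    ∃ᶠ t in atTop, LinSolvable θ η t := by
  rw [frequently_atTop]
  intro a
  have e1 := eventually_const_mul_rpow_lt (sub_neg.2 hγδ) (n * 2 ^ δ) one_half_pos
  have e2 := eventually_const_mul_rpow_lt (by linarith : 1 - γ * (1 + δ) + η < 0)
    (n * 2 ^ (1 + δ)) one_pos
  have hφ : Tendsto (fun Z : ℝ => (2 * Z) ^ γ⁻¹) atTop atTop :=
    (tendsto_rpow_atTop (inv_pos.2 hγ)).comp (tendsto_id.const_mul_atTop two_pos)
  obtain ⟨Q, hQ⟩ := eventually_atTop.1 (hφ.eventually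
    ((e1.and e2).and ((eventually_linSolvable_iff.1 h).and (eventually_ge_atTop (max a 1)))))
  obtain ⟨z, hzQ, hz0, hzE⟩ := exists_large_of_frequently finite_sim (simError_pos hθ hn) hδ
    (frequently_simSolvable_iff.1 h') Q
  obtain ⟨⟨h1, h2⟩, h3, h4⟩ := hQ _ hzQ.le
  set Z := simSize z with hZ
  set t := (2 * Z) ^ γ⁻¹ with ht
  have ht1 : 1 ≤ t := (le_max_right _ _).trans h4
  have ht0 : 0 < t := by linarith
  have htZ : t ^ γ = 2 * Z := by
    rw [ht, ← Real.rpow_mul (by linarith), inv_mul_cancel₀ hγ.ne', Real.rpow_one]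
  have hZt : Z = t ^ γ / 2 := by linarith
  obtain ⟨x, hx1, hx2, hx3⟩ := h3
  refine ⟨t, (le_max_left _ _).trans h4, (linSolvable_iff ht0).2 ⟨x, ?_, hx2, hx3⟩⟩
  have hZpow : ∀ b : ℝ, Z ^ (-b) = 2 ^ b * t ^ (-(γ * b)) := by
    intro b
    rw [hZt, Real.div_rpow (by positivity) two_pos.le, ← Real.rpow_mul ht0.le,
      Real.rpow_neg two_pos.le, div_inv_eq_mul, mul_neg, mul_comm]
  have hprod : linSize x * simError θ z ≤ t * Z ^ (-δ) :=
    mul_le_mul hx3 hzE (norm_nonneg _) ht0.le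
  have hn0 : (0 : ℝ) ≤ n := Nat.cast_nonneg n
  have h5 : n * (t * Z ^ (-δ)) = n * 2 ^ δ * t ^ (1 - γ * δ) := by
    rw [hZpow, sub_eq_add_neg, Real.rpow_add ht0, Real.rpow_one]
    ring
  have h6 := mul_le_mul_of_nonneg_left hprod hn0
  have h7 := simSize_mul_le (θ := θ) z x (by
    rw [Real.rpow_neg ht0.le, htZ] at hx1
    refine (mul_le_mul_of_nonneg_left hx1 hz0.le).trans (le_of_eq ?_)
    field_simp) (by linarith)
  have h8 : Z * |linForm θ x| ≤ n * (t * Z ^ (-δ)) := h7.trans h6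
  have h9 : |linForm θ x| ≤ n * 2 ^ (1 + δ) * t ^ (1 - γ * (1 + δ) + η) * t ^ (-η) := by
    have h10 : n * 2 ^ (1 + δ) * t ^ (1 - γ * (1 + δ) + η) * t ^ (-η) =
        n * (t * Z ^ (-(1 + δ))) := by
      rw [hZpow, mul_assoc, ← Real.rpow_add ht0, add_neg_cancel_right, sub_eq_add_neg,
        Real.rpow_add ht0, Real.rpow_one]
      ring
    rw [h10, neg_add, Real.rpow_add hz0, Real.rpow_neg_one]
    rw [← le_div_iff₀' hz0] at h8
    refine h8.trans (le_of_eq ?_)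
    ring
  refine h9.trans (mul_le_of_le_one_left (Real.rpow_nonneg ht0.le _) h2.le)

theorem frequently_simSolvable_transfer
    (hθ : LinearIndependent ℚ (Fin.cons 1 θ : Fin (n + 1) → ℝ)) (hn : 0 < n) {γ δ η : ℝ}
    (hδ : 0 < δ) (hγδ : 1 < γ * δ) (h : ∀ᶠ t in atTop, SimSolvable θ γ t)
    (h' : ∃ᶠ t in atTop, LinSolvable θ δ t) (hpos : 0 < 1 + δ⁻¹ - γ)
    (hη : (1 + δ⁻¹ - γ) * η < γ) : ∃ᶠ t in atTop, SimSolvable θ η t := by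
  rw [frequently_atTop]
  intro a
  have hn0 : (0 : ℝ) < n := by exact_mod_cast hn
  set α := 1 + δ⁻¹ - γ with hα
  set c : ℝ := n * 2 * 2 ^ δ⁻¹ with hc
  have hc0 : 0 < c := by positivity
  have hδγ : δ⁻¹ - γ < 0 := by
    rw [sub_neg, inv_lt_iff_one_lt_mul₀ hδ]
    exact hγδ
  have e1 := eventually_const_mul_rpow_lt hδγ (n * 2 ^ δ⁻¹) one_half_pos
  have e2 := eventually_const_mul_rpow_lt (by linarith : α * η - γ < 0) (c ^ η) one_pos
  have e3 : ∀ᶠ t : ℝ in atTop, max a 1 ≤ c * t ^ α :=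
    ((tendsto_rpow_atTop hpos).const_mul_atTop hc0).eventually_ge_atTop _
  have hφ : Tendsto (fun X : ℝ => X ^ δ / 2) atTop atTop :=
    (tendsto_rpow_atTop hδ).atTop_div_const two_pos
  obtain ⟨T, hT⟩ := eventually_atTop.1 ((e1.and e2).and (e3.and
    ((eventually_simSolvable_iff.1 h).and (eventually_gt_atTop 0))))
  obtain ⟨Q, hQ⟩ := eventually_atTop.1 (hφ.eventually_ge_atTop T)
  obtain ⟨x, hxQ, hx0, hxE⟩ := exists_large_of_frequently finite_lin (linForm_pos hθ) hδ
    (frequently_linSolvable_iff.1 h') Q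
  set X := linSize x with hX
  have hL0 := linForm_pos hθ x hx0
  set L := |linForm θ x| with hL
  set t := 1 / (2 * L) with ht
  have hLt : L = 1 / (2 * t) := by
    rw [ht]
    field_simp
  have hXt' : X ^ δ ≤ 2 * t := by
    rw [Real.rpow_neg hx0.le] at hxE
    have h1 := inv_anti₀ hL0 hxE
    rw [inv_inv] at h1
    refine h1.trans (le_of_eq ?_)
    rw [ht]
    field_simp
  obtain ⟨⟨h1, h2⟩, h3, h4, ht0⟩ := hT t ((hQ X hxQ.le).trans (by linarith))
  have hXt : X ≤ 2 ^ δ⁻¹ * t ^ δ⁻¹ := by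
    rw [← Real.mul_rpow two_pos.le ht0.le]
    have := Real.rpow_le_rpow (by positivity) hXt' (inv_pos.2 hδ).le
    rwa [← Real.rpow_mul hx0.le, mul_inv_cancel₀ hδ.ne', Real.rpow_one] at this
  obtain ⟨z, hz1, hz2, hz3⟩ := h4
  have hprod : n * (X * simError θ z) ≤ n * 2 ^ δ⁻¹ * t ^ (δ⁻¹ - γ) := by
    have h5 : X * simError θ z ≤ 2 ^ δ⁻¹ * t ^ δ⁻¹ * t ^ (-γ) :=
      mul_le_mul hXt hz1 (norm_nonneg _) (by positivity)
    rw [sub_eq_add_neg, Real.rpow_add ht0]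
    calc _ ≤ n * (2 ^ δ⁻¹ * t ^ δ⁻¹ * t ^ (-γ)) := mul_le_mul_of_nonneg_left h5 hn0.le
      _ = _ := by ring
  have h6 := simSize_mul_le (θ := θ) z x (by
    rw [← hL, hLt]
    refine (mul_le_mul_of_nonneg_right hz3 (by positivity)).trans (le_of_eq ?_)
    field_simp) (by linarith)
  rw [← hL, ← hX] at h6
  have h7 : simSize z ≤ c * t ^ α := by
    have h8 := h6.trans hprod
    rw [hLt, mul_one_div, div_le_iff₀ (by positivity)] at h8
    refine h8.trans (le_of_eq ?_)
    rw [hc, hα, add_sub_assoc, Real.rpow_add ht0, Real.rpow_one]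
    ring
  have hT0 : 0 < c * t ^ α := by positivity
  refine ⟨c * t ^ α, (le_max_left _ _).trans h3, (simSolvable_iff hT0).2 ⟨z, hz1.trans ?_, hz2, h7⟩⟩
  rw [Real.mul_rpow hc0.le (by positivity), ← Real.rpow_mul ht0.le, Real.rpow_neg hc0.le,
    le_inv_mul_iff₀ (by positivity)]
  have h9 : c ^ η * t ^ (-γ) = c ^ η * t ^ (α * η - γ) * t ^ (α * -η) := by
    rw [mul_assoc, ← Real.rpow_add ht0]
    ring_nf
  rw [h9]
  exact mul_le_of_le_one_left (by positivity) h2.le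

end Points

section Roots

variable {m : ℕ} {x y : ℝ}

theorem geo_le_geo (hx : 0 ≤ x) (hxy : x ≤ y) (m : ℕ) : geo x m ≤ geo y m :=
  Finset.sum_le_sum fun _ _ => pow_le_pow_left₀ hx hxy _

theorem geo_lt_geo (hx : 0 ≤ x) (hxy : x < y) (hm : 2 ≤ m) : geo x m < geo y m :=
  Finset.sum_lt_sum (fun _ _ => pow_le_pow_left₀ hx hxy.le _)
    ⟨1, Finset.mem_range.2 (by omega), by simpa using hxy⟩

theorem geo_ratio_anti (hx : 0 ≤ x) (hxy : x ≤ y) (m : ℕ) :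
    geo y m * geo x (m + 1) ≤ geo x m * geo y (m + 1) := by
  have h : geo y m * x ^ m ≤ geo x m * y ^ m := by
    rw [geo, geo, Finset.sum_mul, Finset.sum_mul]
    refine Finset.sum_le_sum fun i hi => ?_
    obtain ⟨j, rfl⟩ := Nat.exists_eq_add_of_le (Finset.mem_range.1 hi).le
    rw [pow_add, pow_add]
    have h1 := pow_le_pow_left₀ hx hxy j
    have h2 : 0 ≤ x ^ i * y ^ i := mul_nonneg (pow_nonneg hx i) (pow_nonneg (hx.trans hxy) i)
    have := mul_le_mul_of_nonneg_left h1 h2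
    linarith
  rw [geo_succ, geo_succ]
  linarith

theorem geo_ratio_strictAnti (hx : 0 < x) (hxy : x < y) (hm : 1 ≤ m) :
    geo y m * geo x (m + 1) < geo x m * geo y (m + 1) := by
  have h : geo y m * x ^ m < geo x m * y ^ m := by
    rw [geo, geo, Finset.sum_mul, Finset.sum_mul]
    refine Finset.sum_lt_sum_of_nonempty (Finset.nonempty_range_iff.2 (by omega)) fun i hi => ?_
    have hi := Finset.mem_range.1 hi
    obtain ⟨j, rfl⟩ := Nat.exists_eq_add_of_le hi.le
    rw [pow_add, pow_add]
    have h1 := pow_lt_pow_left₀ hxy hx.le (by omega : j ≠ 0)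
    have h2 : 0 < x ^ i * y ^ i := mul_pos (pow_pos hx i) (pow_pos (hx.trans hxy) i)
    have := mul_lt_mul_of_pos_left h1 h2
    linarith
  rw [geo_succ, geo_succ]
  linarith

theorem polyLin_isRoot_iff {n : ℕ} {w : ℝ} :
    (polyLin n w).IsRoot x ↔ w⁻¹ * (x ^ n - 1) = x - 1 := by
  simp only [polyLin, Polynomial.IsRoot.def, Polynomial.eval_add, Polynomial.eval_sub,
    Polynomial.eval_mul, Polynomial.eval_C, Polynomial.eval_pow, Polynomial.eval_X]
  constructor <;> intro h <;> linarith

theorem polySim_isRoot_iff {l : ℝ} :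
    (polySim (m + 1) l).IsRoot x ↔ (1 - l) * (x ^ (m + 1) - 1) = x ^ m - 1 := by
  simp only [polySim, Polynomial.IsRoot.def, Polynomial.eval_add, Polynomial.eval_sub,
    Polynomial.eval_mul, Polynomial.eval_C, Polynomial.eval_pow, Polynomial.eval_X,
    Nat.add_sub_cancel]
  constructor <;> intro h <;> linarith

theorem eq_geo_of_isRoot {n : ℕ} {w : ℝ} (hw : 0 < w) (hx : 1 < x) (h : (polyLin n w).IsRoot x) :
    w = geo x n := by
  rw [polyLin_isRoot_iff, ← geo_mul, inv_mul_eq_iff_eq_mul₀ hw.ne'] at h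
  exact (mul_right_cancel₀ (sub_pos.2 hx).ne' h).symm

theorem geo_eq_of_isRoot {l : ℝ} (hx : 1 < x) (h : (polySim (m + 1) l).IsRoot x) :
    (1 - l) * geo x (m + 1) = geo x m := by
  rw [polySim_isRoot_iff, ← geo_mul, ← geo_mul, ← mul_assoc] at h
  exact mul_right_cancel₀ (sub_pos.2 hx).ne' h

theorem largestRoot_polyLin_le {n : ℕ} (hn : 2 ≤ n) {w ρ : ℝ} (hw : 0 < w) (hρ : 1 ≤ ρ)
    (h : w ≤ geo ρ n) : largestRoot (polyLin n w) ≤ ρ := by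
  refine csSup_le ⟨1, polyLin_isRoot_iff.2 (by simp)⟩ fun y hy => ?_
  by_contra! hlt
  have h1 := eq_geo_of_isRoot hw (hρ.trans_lt hlt) hy
  have h2 := geo_lt_geo (by linarith) hlt hn
  linarith

theorem largestRoot_polySim_le (hm : 1 ≤ m) {l ρ : ℝ} (hρ : 1 ≤ ρ)
    (h : geo ρ m ≤ (1 - l) * geo ρ (m + 1)) : largestRoot (polySim (m + 1) l) ≤ ρ := by
  refine csSup_le ⟨1, polySim_isRoot_iff.2 (by simp)⟩ fun y hy => ?_
  by_contra! hlt
  have h1 := geo_eq_of_isRoot (hρ.trans_lt hlt) hy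
  have h2 := geo_ratio_strictAnti (by linarith) hlt hm
  have h3 := mul_le_mul_of_nonneg_right h (geo_nonneg (by linarith : 0 ≤ y) (m + 1))
  rw [← h1] at h2
  linarith

theorem isRoot_largestRoot_polyLin {n : ℕ} (hn : n ≠ 0) {w : ℝ} (hw : 1 < w) :
    (polyLin n w).IsRoot (largestRoot (polyLin n w)) := by
  refine (isGreatest_largestRoot (fun h => ?_) (x := 1) (polyLin_isRoot_iff.2 (by simp))).1
  have h1 : (polyLin n w).IsRoot 0 := by simp [h]
  rw [polyLin_isRoot_iff, zero_pow hn] at h1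
  have := inv_lt_one_of_one_lt₀ hw
  linarith

theorem isRoot_largestRoot_polySim (hm : m ≠ 0) {l : ℝ} (hl : l ≠ 0) :
    (polySim (m + 1) l).IsRoot (largestRoot (polySim (m + 1) l)) := by
  refine (isGreatest_largestRoot (fun h => ?_) (x := 1) (polySim_isRoot_iff.2 (by simp))).1
  have h1 : (polySim (m + 1) l).IsRoot 0 := by simp [h]
  rw [polySim_isRoot_iff, zero_pow hm, zero_pow (Nat.succ_ne_zero m)] at h1
  exact hl (by linarith)

/-- A root of `polySim` is at most `1 / (1 - l)`. -/
theorem root_polySim_mul_le {l : ℝ} (hl0 : 0 ≤ l) (hl1 : l ≤ 1)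
    (h : (polySim (m + 1) l).IsRoot y) : y * (1 - l) ≤ 1 := by
  rcases le_or_gt y 1 with hy | hy
  · nlinarith
  · have h1 := geo_eq_of_isRoot hy h
    have h2 := geo_succ_pos (by linarith : 0 ≤ y) m
    have h3 := geo_succ' y m
    rw [← h1] at h3
    nlinarith

theorem min_root_mul_le {w l : ℝ} (hw : 1 < w) (hl1 : l ≤ 1) (hwl : w⁻¹ ≤ l)
    (hx : (polyLin (m + 1) w).IsRoot x) (hy : (polySim (m + 1) l).IsRoot y) :
    min x y * (1 - l) ≤ 1 - w⁻¹ := by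
  by_cases hmin : min x y ≤ 1
  · have := mul_le_mul_of_nonneg_right hmin (sub_nonneg.2 hl1)
    linarith
  rw [not_le, lt_min_iff] at hmin
  obtain ⟨hx1, hy1⟩ := hmin
  have hw' := eq_geo_of_isRoot (by linarith) hx1 hx
  have hl' := geo_eq_of_isRoot hy1 hy
  have hSx := geo_succ_pos (by linarith : 0 ≤ x) m
  have hSy := geo_succ_pos (by linarith : 0 ≤ y) m
  have h1 : 1 - l = geo y m / geo y (m + 1) := by
    rw [eq_div_iff hSy.ne']
    exact hl'
  rcases le_total x y with hxy | hxy
  · rw [min_eq_left hxy, h1, hw']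
    have h2 : 1 - (geo x (m + 1))⁻¹ = x * (geo x m / geo x (m + 1)) := by
      field_simp
      rw [geo_succ']
      ring
    rw [h2]
    refine mul_le_mul_of_nonneg_left ?_ (by linarith)
    rw [div_le_div_iff₀ hSy hSx]
    exact geo_ratio_anti (by linarith) hxy m
  · rw [min_eq_right hxy, h1, hw']
    have h2 : y * (geo y m / geo y (m + 1)) = 1 - (geo y (m + 1))⁻¹ := by
      field_simp
      rw [geo_succ']
      ring
    rw [h2]
    exact sub_le_sub_left (inv_anti₀ hSy (geo_le_geo (by linarith) hxy _)) 1

end Roots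

section Exponents

variable {P : ℝ → ℝ → Prop}

/-- Below the supremum in `[0, ∞]` of the `γ` such that `P γ t` for all large `t`, every exponent
has this property. -/
theorem eventually_of_lt_sSup (hP : ∀ γ γ' t, 1 ≤ t → γ ≤ γ' → P γ' t → P γ t) {γ : ℝ}
    (h : ENNReal.ofReal γ < sSup (ENNReal.ofReal '' {γ : ℝ | ∀ᶠ t in atTop, P γ t})) :
    ∀ᶠ t in atTop, P γ t := by
  obtain ⟨_, ⟨γ', hγ', rfl⟩, hlt⟩ := lt_sSup_iff.1 h
  have hle : γ ≤ γ' := by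
    by_contra! hn
    exact absurd (ENNReal.ofReal_le_ofReal hn.le) (not_le.2 hlt)
  filter_upwards [hγ', eventually_ge_atTop 1] with t ht ht1
  exact hP γ γ' t ht1 hle ht

theorem frequently_of_lt_sSup (hP : ∀ γ γ' t, 1 ≤ t → γ ≤ γ' → P γ' t → P γ t) {γ : ℝ}
    (h : ENNReal.ofReal γ < sSup (ENNReal.ofReal '' {γ : ℝ | ∃ᶠ t in atTop, P γ t})) :
    ∃ᶠ t in atTop, P γ t := by
  obtain ⟨_, ⟨γ', hγ', rfl⟩, hlt⟩ := lt_sSup_iff.1 h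
  have hle : γ ≤ γ' := by
    by_contra! hn
    exact absurd (ENNReal.ofReal_le_ofReal hn.le) (not_le.2 hlt)
  exact (hγ'.and_eventually (eventually_ge_atTop 1)).mono fun t ht => hP γ γ' t ht.2 hle ht.1

theorem eventually_not_of_sSup_lt {γ : ℝ}
    (h : sSup (ENNReal.ofReal '' {γ : ℝ | ∃ᶠ t in atTop, P γ t}) < ENNReal.ofReal γ) :
    ∀ᶠ t in atTop, ¬ P γ t := by
  rw [← not_frequently]
  intro hf
  exact absurd (le_sSup (Set.mem_image_of_mem _ hf)) (not_le.2 h)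

theorem sSup_eventually_le_sSup_frequently :
    sSup (ENNReal.ofReal '' {γ : ℝ | ∀ᶠ t in atTop, P γ t}) ≤
      sSup (ENNReal.ofReal '' {γ : ℝ | ∃ᶠ t in atTop, P γ t}) :=
  sSup_le_sSup (Set.image_mono fun _ h => Eventually.frequently h)

variable {n : ℕ} {θ : Fin n → ℝ}

theorem SimSolvable.mono {γ γ' t : ℝ} (ht : 1 ≤ t) (h : γ ≤ γ') :
    SimSolvable θ γ' t → SimSolvable θ γ t := fun ⟨x, hx, hx'⟩ =>
  ⟨x, fun i => (hx i).trans (Real.rpow_le_rpow_of_exponent_le ht (neg_le_neg h)), hx'⟩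

theorem LinSolvable.mono {γ γ' t : ℝ} (ht : 1 ≤ t) (h : γ ≤ γ') :
    LinSolvable θ γ' t → LinSolvable θ γ t := fun ⟨x, hx, hx'⟩ =>
  ⟨x, hx.trans (Real.rpow_le_rpow_of_exponent_le ht (neg_le_neg h)), hx'⟩

theorem eventually_simSolvable {γ : ℝ} (h : ENNReal.ofReal γ < lamUnif θ) :
    ∀ᶠ t in atTop, SimSolvable θ γ t :=
  eventually_of_lt_sSup (P := SimSolvable θ) (fun _ _ _ ht hle => SimSolvable.mono ht hle) h

theorem eventually_linSolvable {γ : ℝ} (h : ENNReal.ofReal γ < omegaUnif θ) :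
    ∀ᶠ t in atTop, LinSolvable θ γ t :=
  eventually_of_lt_sSup (P := LinSolvable θ) (fun _ _ _ ht hle => LinSolvable.mono ht hle) h

theorem frequently_simSolvable {γ : ℝ} (h : ENNReal.ofReal γ < lamReg θ) :
    ∃ᶠ t in atTop, SimSolvable θ γ t :=
  frequently_of_lt_sSup (P := SimSolvable θ) (fun _ _ _ ht hle => SimSolvable.mono ht hle) h

theorem frequently_linSolvable {γ : ℝ} (h : ENNReal.ofReal γ < omegaReg θ) :
    ∃ᶠ t in atTop, LinSolvable θ γ t :=
  frequently_of_lt_sSup (P := LinSolvable θ) (fun _ _ _ ht hle => LinSolvable.mono ht hle) h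

theorem lamUnif_le_lamReg : lamUnif θ ≤ lamReg θ := sSup_eventually_le_sSup_frequently

theorem omegaUnif_le_omegaReg : omegaUnif θ ≤ omegaReg θ := sSup_eventually_le_sSup_frequently

theorem natCast_le_omegaUnif (hn : n ≠ 0) (θ : Fin n → ℝ) : (n : ℝ≥0∞) ≤ omegaUnif θ := by
  refine le_of_forall_lt fun c hc => ?_
  obtain ⟨r, hcr, hr⟩ := ENNReal.lt_iff_exists_nnreal_btwn.1 hc
  refine hcr.trans_le (le_sSup ⟨r, eventually_linSolvable_of_lt hn θ ?_, ENNReal.ofReal_coe_nnreal⟩)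
  exact_mod_cast hr

theorem inv_natCast_le_lamUnif (hn : n ≠ 0) (θ : Fin n → ℝ) : (n : ℝ≥0∞)⁻¹ ≤ lamUnif θ := by
  refine le_of_forall_lt fun c hc => ?_
  obtain ⟨r, hcr, hr⟩ := ENNReal.lt_iff_exists_nnreal_btwn.1 hc
  refine hcr.trans_le (le_sSup ⟨r, eventually_simSolvable_of_lt θ r.2 ?_,
    ENNReal.ofReal_coe_nnreal⟩)
  have hn' : (0 : ℝ) < n := by exact_mod_cast Nat.pos_of_ne_zero hn
  rw [← ENNReal.coe_natCast, ← ENNReal.coe_inv (by exact_mod_cast hn), ENNReal.coe_lt_coe] at hr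
  have h1 : (r : ℝ) < (n : ℝ)⁻¹ := by exact_mod_cast hr
  calc (r : ℝ) * n < (n : ℝ)⁻¹ * n := mul_lt_mul_of_pos_right h1 hn'
    _ = 1 := inv_mul_cancel₀ hn'.ne'

theorem lamUnif_le_one (hθ : LinearIndependent ℚ (Fin.cons 1 θ : Fin (n + 1) → ℝ))
    (hn : 0 < n) : lamUnif θ ≤ 1 := by
  refine sSup_le ?_
  rintro _ ⟨γ, hγ, rfl⟩
  exact ENNReal.ofReal_le_one.2 (le_one_of_eventually_simSolvable hθ hn hγ)

theorem continuous_geo (m : ℕ) : Continuous fun r => geo r m :=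
  continuous_finsetSum _ fun _ _ => continuous_pow _

theorem ofReal_sub_lt {a : ℝ≥0∞} (ha : a ≠ ⊤) {ε : ℝ} (hε : 0 < ε) (ha0 : 0 < a.toReal) :
    ENNReal.ofReal (a.toReal - ε) < a :=
  ((ENNReal.ofReal_lt_ofReal_iff ha0).2 (by linarith)).trans_eq (ENNReal.ofReal_toReal ha)

theorem lt_ofReal_add {a : ℝ≥0∞} (ha : a ≠ ⊤) {ε : ℝ} (hε : 0 < ε) :
    a < ENNReal.ofReal (a.toReal + ε) :=
  (ENNReal.lt_ofReal_iff_toReal_lt ha).2 (by linarith)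

theorem geo_le_of_lamReg_ne_top {e : ℕ} {θ : Fin (e + 1) → ℝ}
    (hθ : LinearIndependent ℚ (Fin.cons 1 θ : Fin (e + 1 + 1) → ℝ)) (h0 : 0 < (lamUnif θ).toReal)
    (hU : lamUnif θ ≠ ⊤) (hR : lamReg θ ≠ ⊤) :
    geo ((lamReg θ).toReal / (lamUnif θ).toReal) e ≤
      (1 - (lamUnif θ).toReal) * geo ((lamReg θ).toReal / (lamUnif θ).toReal) (e + 1) := by
  set c := (lamUnif θ).toReal with hc
  set d := (lamReg θ).toReal with hd
  have hd0 : 0 ≤ d := ENNReal.toReal_nonneg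
  have hq : Tendsto (fun ε : ℝ => (d + ε) / (c - ε)) (𝓝[>] 0) (𝓝 (d / c)) := by
    have : ContinuousAt (fun ε : ℝ => (d + ε) / (c - ε)) 0 :=
      ContinuousAt.div (by fun_prop) (by fun_prop) (by simpa using h0.ne')
    have h1 := this.tendsto.mono_left (nhdsWithin_le_nhds (s := Set.Ioi 0))
    simpa using h1
  have hs : Tendsto (fun ε : ℝ => 1 - (c - ε)) (𝓝[>] 0) (𝓝 (1 - c)) := by
    have : ContinuousAt (fun ε : ℝ => 1 - (c - ε)) 0 := by fun_prop
    have h1 := this.tendsto.mono_left (nhdsWithin_le_nhds (s := Set.Ioi 0))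
    simpa using h1
  refine le_of_tendsto_of_tendsto (((continuous_geo e).tendsto _).comp hq)
    (hs.mul (((continuous_geo (e + 1)).tendsto _).comp hq)) ?_
  filter_upwards [self_mem_nhdsWithin, Ioo_mem_nhdsGT h0] with ε hε hεc
  have hε : 0 < ε := hε
  exact geo_le_of_simSolvable hθ (by linarith [hεc.2]) (by linarith)
    (eventually_simSolvable (ofReal_sub_lt hU hε h0))
    (eventually_not_of_sSup_lt (lt_ofReal_add hR hε))

theorem le_geo_of_omegaReg_ne_top (hθ : LinearIndependent ℚ (Fin.cons 1 θ : Fin (n + 1) → ℝ))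
    (h0 : 0 < (omegaUnif θ).toReal) (hU : omegaUnif θ ≠ ⊤) (hR : omegaReg θ ≠ ⊤) :
    (omegaUnif θ).toReal ≤ geo ((omegaReg θ).toReal / (omegaUnif θ).toReal) n := by
  set c := (omegaUnif θ).toReal with hc
  set d := (omegaReg θ).toReal with hd
  have hd0 : 0 ≤ d := ENNReal.toReal_nonneg
  have hq : Tendsto (fun ε : ℝ => (d + ε) / (c - ε)) (𝓝[>] 0) (𝓝 (d / c)) := by
    have : ContinuousAt (fun ε : ℝ => (d + ε) / (c - ε)) 0 :=
      ContinuousAt.div (by fun_prop) (by fun_prop) (by simpa using h0.ne')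
    have h1 := this.tendsto.mono_left (nhdsWithin_le_nhds (s := Set.Ioi 0))
    simpa using h1
  have hs : Tendsto (fun ε : ℝ => c - ε) (𝓝[>] 0) (𝓝 c) := by
    have : ContinuousAt (fun ε : ℝ => c - ε) 0 := by fun_prop
    have h1 := this.tendsto.mono_left (nhdsWithin_le_nhds (s := Set.Ioi 0))
    simpa using h1
  refine le_of_tendsto_of_tendsto hs (((continuous_geo n).tendsto _).comp hq) ?_
  filter_upwards [self_mem_nhdsWithin, Ioo_mem_nhdsGT h0] with ε hε hεc
  have hε : 0 < ε := hε
  exact le_geo_of_linSolvable hθ (by linarith [hεc.2]) (by linarith)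
    (eventually_linSolvable (ofReal_sub_lt hU hε h0))
    (eventually_not_of_sSup_lt (lt_ofReal_add hR hε))

theorem mul_one_add_le_of_lt (hθ : LinearIndependent ℚ (Fin.cons 1 θ : Fin (n + 1) → ℝ))
    (hn : 0 < n) (hR : omegaReg θ ≠ ⊤) {γ δ : ℝ} (hγ : 0 < γ) (hδ : 0 < δ)
    (hγU : ENNReal.ofReal γ < omegaUnif θ) (hδR : ENNReal.ofReal δ < lamReg θ) :
    γ * (1 + δ) ≤ 1 + (omegaReg θ).toReal := by
  by_cases h1 : γ * δ ≤ 1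
  · have h2 := (ENNReal.ofReal_le_iff_le_toReal hR).1 (hγU.le.trans omegaUnif_le_omegaReg)
    linarith
  · have h2 : γ * (1 + δ) - 1 ≤ (omegaReg θ).toReal := by
      refine le_of_forall_lt_imp_le_of_dense fun η hη => ?_
      rw [← ENNReal.ofReal_le_iff_le_toReal hR]
      exact le_sSup ⟨η, frequently_linSolvable_transfer hθ hn hγ hδ (not_le.1 h1)
        (eventually_linSolvable hγU) (frequently_simSolvable hδR) hη, rfl⟩
    linarith

theorem lamReg_ne_top (hθ : LinearIndependent ℚ (Fin.cons 1 θ : Fin (n + 1) → ℝ))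
    (hn : 2 ≤ n) (hR : omegaReg θ ≠ ⊤) : lamReg θ ≠ ⊤ := by
  intro h
  have h0 : 0 ≤ (omegaReg θ).toReal := ENNReal.toReal_nonneg
  have := mul_one_add_le_of_lt hθ (by omega) hR (γ := 1) (δ := (omegaReg θ).toReal + 1) one_pos
    (by linarith) (by
      rw [ENNReal.ofReal_one]
      refine lt_of_lt_of_le ?_ (natCast_le_omegaUnif (by omega) θ)
      exact_mod_cast (by omega : 1 < n)) (by rw [h]; exact ENNReal.ofReal_lt_top)
  linarith

theorem omegaUnif_mul_le (hθ : LinearIndependent ℚ (Fin.cons 1 θ : Fin (n + 1) → ℝ))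
    (hn : 0 < n) (hR : omegaReg θ ≠ ⊤) (hU : omegaUnif θ ≠ ⊤) (hl : lamReg θ ≠ ⊤)
    (hU0 : 0 < (omegaUnif θ).toReal) (hl0 : 0 < (lamReg θ).toReal) :
    (omegaUnif θ).toReal * (1 + (lamReg θ).toReal) ≤ 1 + (omegaReg θ).toReal := by
  set a := (omegaUnif θ).toReal with ha
  set d := (lamReg θ).toReal with hd
  have hs : Tendsto (fun ε : ℝ => (a - ε) * (1 + (d - ε))) (𝓝[>] 0) (𝓝 (a * (1 + d))) := by
    have : ContinuousAt (fun ε : ℝ => (a - ε) * (1 + (d - ε))) 0 := by fun_prop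
    have h1 := this.tendsto.mono_left (nhdsWithin_le_nhds (s := Set.Ioi 0))
    simpa using h1
  refine le_of_tendsto hs ?_
  filter_upwards [Ioo_mem_nhdsGT hU0, Ioo_mem_nhdsGT hl0] with ε hε hε'
  exact mul_one_add_le_of_lt hθ hn hR (by linarith [hε.2]) (by linarith [hε'.2])
    (ofReal_sub_lt hU hε.1 hU0) (ofReal_sub_lt hl hε.1 hl0)

theorem lamUnif_mul_le (hθ : LinearIndependent ℚ (Fin.cons 1 θ : Fin (n + 1) → ℝ))
    (hn : 0 < n) (hl : lamReg θ ≠ ⊤) (hU0 : 0 < (lamUnif θ).toReal) (hw0 : omegaReg θ ≠ 0) :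
    (lamUnif θ).toReal * (1 + (lamReg θ).toReal) ≤
      (lamReg θ).toReal * (1 + (omegaReg θ)⁻¹.toReal) := by
  have hU1 := lamUnif_le_one hθ hn
  have hU : lamUnif θ ≠ ⊤ := ne_top_of_le_ne_top ENNReal.one_ne_top hU1
  have hUl : (lamUnif θ).toReal ≤ (lamReg θ).toReal := ENNReal.toReal_mono hl lamUnif_le_lamReg
  have hc1 : (lamUnif θ).toReal ≤ 1 := by
    simpa using ENNReal.toReal_mono ENNReal.one_ne_top hU1
  set c := (lamUnif θ).toReal with hc
  set d := (lamReg θ).toReal with hd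
  set w := (omegaReg θ)⁻¹.toReal with hw
  have hw' : 0 ≤ w := ENNReal.toReal_nonneg
  have hs : Tendsto (fun ε : ℝ => (c - ε) * (1 + d)) (𝓝[>] 0) (𝓝 (c * (1 + d))) := by
    have : ContinuousAt (fun ε : ℝ => (c - ε) * (1 + d)) 0 := by fun_prop
    have h1 := this.tendsto.mono_left (nhdsWithin_le_nhds (s := Set.Ioi 0))
    simpa using h1
  have hs' : Tendsto (fun ε : ℝ => d * (1 + (w + ε))) (𝓝[>] 0) (𝓝 (d * (1 + w))) := by
    have : ContinuousAt (fun ε : ℝ => d * (1 + (w + ε))) 0 := by fun_prop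
    have h1 := this.tendsto.mono_left (nhdsWithin_le_nhds (s := Set.Ioi 0))
    simpa using h1
  refine le_of_tendsto_of_tendsto hs hs' ?_
  filter_upwards [Ioo_mem_nhdsGT hU0] with ε hε
  have hv : 0 < w + ε := by linarith [hε.1]
  have hγ0 : 0 < c - ε := by linarith [hε.2]
  by_cases h1 : (c - ε) * (w + ε)⁻¹ ≤ 1
  · rw [← div_eq_mul_inv, div_le_one hv] at h1
    have := mul_le_mul_of_nonneg_left h1 (hU0.le.trans hUl)
    linarith [hε.1]
  · have hδR : ENNReal.ofReal (w + ε)⁻¹ < omegaReg θ := by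
      rw [ENNReal.ofReal_inv_of_pos hv, ENNReal.inv_lt_iff_inv_lt]
      exact lt_ofReal_add (ENNReal.inv_ne_top.2 hw0) hε.1
    have hpos : 0 < 1 + (w + ε)⁻¹⁻¹ - (c - ε) := by
      rw [inv_inv]
      linarith [hε.1]
    have h2 : (c - ε) / (1 + (w + ε)⁻¹⁻¹ - (c - ε)) ≤ d := by
      refine le_of_forall_lt_imp_le_of_dense fun η hη => ?_
      rw [← ENNReal.ofReal_le_iff_le_toReal hl]
      refine le_sSup ⟨η, frequently_simSolvable_transfer hθ hn (inv_pos.2 hv) (not_le.1 h1)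
        (eventually_simSolvable (ofReal_sub_lt hU hε.1 hU0)) (frequently_linSolvable hδR) hpos ?_,
        rfl⟩
      rwa [lt_div_iff₀' hpos] at hη
    rw [div_le_iff₀ hpos, inv_inv] at h2
    linarith

end Exponents

theorem Aquot_eq_ofReal {a c : ℝ≥0∞} (ha : a ≠ 0) (hc : c < 1) :
    Aquot a c = ENNReal.ofReal ((1 - a⁻¹.toReal) / (1 - c.toReal)) := by
  have hc' : c ≠ ⊤ := hc.ne_top
  have h1 : c.toReal < 1 := by
    simpa using (ENNReal.toReal_lt_toReal hc' ENNReal.one_ne_top).2 hc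
  rw [ENNReal.ofReal_div_of_pos (by linarith), ENNReal.ofReal_sub _ ENNReal.toReal_nonneg,
    ENNReal.ofReal_sub _ ENNReal.toReal_nonneg, ENNReal.ofReal_one,
    ENNReal.ofReal_toReal (ENNReal.inv_ne_top.2 ha), ENNReal.ofReal_toReal hc', Aquot]

theorem Bquot_eq_ofReal {b d : ℝ≥0∞} (hb : b ≠ 0) (hd : d ≠ ⊤) :
    Bquot b d = ENNReal.ofReal ((1 + d.toReal) / (1 + b⁻¹.toReal)) := by
  have h1 : 0 ≤ b⁻¹.toReal := ENNReal.toReal_nonneg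
  rw [ENNReal.ofReal_div_of_pos (by linarith), ENNReal.ofReal_add one_pos.le ENNReal.toReal_nonneg,
    ENNReal.ofReal_add one_pos.le h1, ENNReal.ofReal_one,
    ENNReal.ofReal_toReal (ENNReal.inv_ne_top.2 hb), ENNReal.ofReal_toReal hd, Bquot]

theorem div_eq_ofReal {b a : ℝ≥0∞} (ha : 0 < a.toReal) (ha' : a ≠ ⊤) (hb : b ≠ ⊤) :
    b / a = ENNReal.ofReal (b.toReal / a.toReal) := by
  rw [ENNReal.ofReal_div_of_pos ha, ENNReal.ofReal_toReal ha', ENNReal.ofReal_toReal hb]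

theorem corollary3 (n : ℕ) (hn : 2 ≤ n) (θ : Fin n → ℝ)
    (hθ : LinearIndependent ℚ (Fin.cons 1 θ : Fin (n + 1) → ℝ)) :
    (omegaUnif θ ≠ ⊤ →
      omegaReg θ / omegaUnif θ ≥
        max (Bquot (omegaReg θ) (lamReg θ)) (Glin n (omegaUnif θ))) ∧
    (omegaUnif θ = ⊤ → omegaReg θ = ⊤) ∧
    lamReg θ / lamUnif θ ≥ max (Bquot (omegaReg θ) (lamReg θ)) (Gsim n (lamUnif θ)) ∧
    Bquot (omegaReg θ) (lamReg θ) ≥ Aquot (omegaUnif θ) (lamUnif θ) ∧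
    Aquot (omegaUnif θ) (lamUnif θ) ≥ min (Glin n (omegaUnif θ)) (Gsim n (lamUnif θ)) := by
  obtain ⟨e, rfl⟩ : ∃ e, n = e + 1 := ⟨n - 1, by omega⟩
  have he : 1 ≤ e := by omega
  have hn0 : 0 < e + 1 := Nat.succ_pos e
  have hab : omegaUnif θ ≤ omegaReg θ := omegaUnif_le_omegaReg
  have hcd : lamUnif θ ≤ lamReg θ := lamUnif_le_lamReg
  have hna := natCast_le_omegaUnif hn0.ne' θ
  have hnc := inv_natCast_le_lamUnif hn0.ne' θ
  have hc1 := lamUnif_le_one hθ hn0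
  have hbd : omegaReg θ ≠ ⊤ → lamReg θ ≠ ⊤ := lamReg_ne_top hθ hn
  have h2a : (2 : ℝ≥0∞) ≤ omegaUnif θ := le_trans (by exact_mod_cast hn) hna
  have ha0 : omegaUnif θ ≠ 0 := fun h => by simp [h] at h2a
  have hb0 : omegaReg θ ≠ 0 := fun h => ha0 (le_antisymm (h ▸ hab) bot_le)
  have hc0 : lamUnif θ ≠ 0 := fun h => by
    rw [h, nonpos_iff_eq_zero, ENNReal.inv_eq_zero] at hnc
    exact ENNReal.natCast_ne_top _ hnc
  have hcT : lamUnif θ ≠ ⊤ := ne_top_of_le_ne_top ENNReal.one_ne_top hc1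
  have hcpos : 0 < (lamUnif θ).toReal := ENNReal.toReal_pos hc0 hcT
  have hI1 : omegaReg θ ≠ ⊤ →
      (omegaUnif θ).toReal * (1 + (lamReg θ).toReal) ≤ 1 + (omegaReg θ).toReal := fun hb =>
    omegaUnif_mul_le hθ hn0 hb (ne_top_of_le_ne_top hb hab) (hbd hb)
      (ENNReal.toReal_pos ha0 (ne_top_of_le_ne_top hb hab))
      (hcpos.trans_le (ENNReal.toReal_mono (hbd hb) hcd))
  have hI2 : lamReg θ ≠ ⊤ → (lamUnif θ).toReal * (1 + (lamReg θ).toReal) ≤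
      (lamReg θ).toReal * (1 + (omegaReg θ)⁻¹.toReal) := fun hd =>
    lamUnif_mul_le hθ hn0 hd hcpos hb0
  have hG : lamReg θ ≠ ⊤ → geo ((lamReg θ).toReal / (lamUnif θ).toReal) e ≤
      (1 - (lamUnif θ).toReal) * geo ((lamReg θ).toReal / (lamUnif θ).toReal) (e + 1) :=
    geo_le_of_lamReg_ne_top hθ hcpos hcT
  have hF : omegaReg θ ≠ ⊤ →
      (omegaUnif θ).toReal ≤ geo ((omegaReg θ).toReal / (omegaUnif θ).toReal) (e + 1) := fun hb =>
    le_geo_of_omegaReg_ne_top hθ (ENNReal.toReal_pos ha0 (ne_top_of_le_ne_top hb hab))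
      (ne_top_of_le_ne_top hb hab) hb
  generalize omegaUnif θ = a at *
  generalize omegaReg θ = b at *
  generalize lamUnif θ = c at *
  generalize lamReg θ = d at *
  have hw0 : 0 ≤ b⁻¹.toReal := ENNReal.toReal_nonneg
  have hx2 : a⁻¹.toReal ≤ 1 / 2 := by
    have := ENNReal.toReal_mono (by simp) (ENNReal.inv_le_inv.2 h2a)
    simpa using this
  have hc1' : c.toReal ≤ 1 := by simpa using ENNReal.toReal_mono ENNReal.one_ne_top hc1
  refine ⟨fun haT => ?_, fun h => top_le_iff.1 (h ▸ hab), ?_, ?_, ?_⟩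
  · rcases eq_or_ne b ⊤ with rfl | hb
    · rw [ENNReal.top_div_of_ne_top haT]
      exact le_top
    have hapos := ENNReal.toReal_pos ha0 haT
    have hbpos := ENNReal.toReal_pos hb0 hb
    rw [ge_iff_le, div_eq_ofReal hapos haT hb, Bquot_eq_ofReal hb0 (hbd hb)]
    refine max_le (ENNReal.ofReal_le_ofReal ?_) ?_
    · rw [div_le_div_iff₀ (by linarith) hapos, ENNReal.toReal_inv, mul_add,
        mul_inv_cancel₀ hbpos.ne']
      linarith [hI1 hb]
    · rw [Glin, if_neg haT]
      refine ENNReal.ofReal_le_ofReal (largestRoot_polyLin_le hn hapos ?_ (hF hb))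
      rw [one_le_div hapos]
      exact ENNReal.toReal_mono hb hab
  · rcases eq_or_ne d ⊤ with rfl | hd
    · rw [ENNReal.top_div_of_ne_top hcT]
      exact le_top
    have hcd' := ENNReal.toReal_mono hd hcd
    have hρ : 1 ≤ d.toReal / c.toReal := by rwa [one_le_div hcpos]
    rw [ge_iff_le, div_eq_ofReal hcpos hcT hd, Bquot_eq_ofReal hb0 hd]
    refine max_le (ENNReal.ofReal_le_ofReal ?_) ?_
    · rw [div_le_div_iff₀ (by linarith) hcpos]
      linarith [hI2 hd]
    · have hc : c ≠ 1 := by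
        rintro rfl
        have h1 := hG hd
        obtain ⟨k, rfl⟩ : ∃ k, e = k + 1 := ⟨e - 1, by omega⟩
        have h2 := geo_succ_pos (zero_le_one.trans hρ) k
        simp only [ENNReal.toReal_one, sub_self, zero_mul] at h1 h2
        linarith
      rw [Gsim, if_neg hc]
      exact ENNReal.ofReal_le_ofReal (largestRoot_polySim_le he hρ (hG hd))
  · rcases eq_or_ne d ⊤ with rfl | hd
    · have hb : b = ⊤ := by
        by_contra hb
        exact hbd hb rfl
      simp [Bquot, hb]
    have hd0 : 0 ≤ d.toReal := ENNReal.toReal_nonneg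
    have hI1' : b⁻¹.toReal * (1 + d.toReal) ≤ a⁻¹.toReal * (1 + b⁻¹.toReal) := by
      rcases eq_or_ne b ⊤ with rfl | hb
      · simp
      have haT := ne_top_of_le_ne_top hb hab
      have hapos := ENNReal.toReal_pos ha0 haT
      have hbpos := ENNReal.toReal_pos hb0 hb
      rw [ENNReal.toReal_inv, ENNReal.toReal_inv]
      have h1 := hI1 hb
      field_simp
      linarith
    have h2 := hI2 hd
    have hc : c < 1 := by
      refine lt_of_le_of_ne hc1 ?_
      rintro rfl
      rw [ENNReal.toReal_one] at h2
      nlinarith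
    have hc' : c.toReal < 1 := by
      simpa using (ENNReal.toReal_lt_toReal hcT ENNReal.one_ne_top).2 hc
    rw [ge_iff_le, Aquot_eq_ofReal ha0 hc, Bquot_eq_ofReal hb0 hd]
    refine ENNReal.ofReal_le_ofReal ?_
    rw [div_le_div_iff₀ (by linarith) (by linarith)]
    linarith
  · rcases eq_or_ne c 1 with rfl | hc
    · have h1 : (1 : ℝ≥0∞) - a⁻¹ ≠ 0 := by
        rw [Ne, tsub_eq_zero_iff_le, not_le, ENNReal.inv_lt_one]
        exact lt_of_lt_of_le (by norm_num) h2a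
      rw [Aquot, tsub_self, ENNReal.div_zero h1]
      exact le_top
    have hclt : c < 1 := lt_of_le_of_ne hc1 hc
    have hc' : c.toReal < 1 := by
      simpa using (ENNReal.toReal_lt_toReal hcT ENNReal.one_ne_top).2 hclt
    have hY := isRoot_largestRoot_polySim (m := e) (by omega) hcpos.ne'
    rw [ge_iff_le, Aquot_eq_ofReal ha0 hclt, Gsim, if_neg hc]
    rcases eq_or_ne a ⊤ with rfl | haT
    · refine (min_le_right _ _).trans (ENNReal.ofReal_le_ofReal ?_)
      rw [le_div_iff₀ (by linarith)]
      simpa using root_polySim_mul_le hcpos.le hc1' hY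
    · have hapos := ENNReal.toReal_pos ha0 haT
      have ha1 : 1 < a.toReal := by
        have := ENNReal.toReal_mono haT h2a
        rw [ENNReal.toReal_ofNat] at this
        linarith
      have hX := isRoot_largestRoot_polyLin (n := e + 1) (by omega) ha1
      rw [Glin, if_neg haT, ← ENNReal.ofReal_min]
      refine ENNReal.ofReal_le_ofReal ?_
      rw [le_div_iff₀ (by linarith), ENNReal.toReal_inv]
      refine min_root_mul_le ha1 hc1' ?_ hX hY
      have h1 := ENNReal.toReal_mono hcT ((ENNReal.inv_le_inv.2 hna).trans hnc)
      rwa [ENNReal.toReal_inv] at h1
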